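/- Call a lattice $\Lambda\subset\mathbb{R}^2$ (a discrete subgroup spanning $\mathbb{R}^2$) unimodular if it has covolume $1$, and rational if there is a positive rational number $d$ such that every vector of $\Lambda$ lies in $\sqrt{d}\cdot\mathbb{Q}^2$. Let $$\mathcal{Z}=\left\{\inf_{(x,y)\in\Lambda,\ xy\neq 0}|xy| \;:\; \Lambda \text{ is a unimodular rational lattice of } \mathbb{R}^2\right\}\subset\mathbb{R}.$$ A Markoff number is a positive integer $m$ that occurs as an entry of a solution of $x^2+y^2+z^2=3xyz$ in positive integers. A limit point of a set $S\subset\mathbb{R}$ is a real number every neighbourhood of which contains a point of $S$ different from it. For every Markoff number $m$, the number $$\frac{2m}{\sqrt{9m^2-4}+3m}$$ is a limit point of $\mathcal{Z}\cap(\tfrac13,\infty)$. Conversely, every limit point of $\mathcal{Z}$ that is larger than $\tfrac13$ is of this form for some Markoff number $m$. -/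

import Mathlib

open Set Filter Topology MeasureTheory

/-- A unimodular lattice of `ℝ²`: a discrete subgroup spanning `ℝ²` over `ℝ`, of covolume `1`
for Lebesgue measure. -/
def IsUnimodularLattice (Λ : Submodule ℤ (Fin 2 → ℝ)) : Prop :=
  ∃ _ : DiscreteTopology Λ, IsZLattice ℝ Λ ∧ ZLattice.covolume Λ = 1

/-- `Λ` is rational: for some positive rational `d`, all vectors of `Λ` lie in `√d · ℚ²`. -/
def IsRationalLattice (Λ : Submodule ℤ (Fin 2 → ℝ)) : Prop :=
  ∃ d : ℚ, 0 < d ∧ ∀ v ∈ Λ, ∀ i : Fin 2, ∃ q : ℚ, v i = √(d : ℝ) * (q : ℝ)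

/-- The infimum of `|xy|` over the `(x, y) ∈ Λ` with `xy ≠ 0`. -/
noncomputable def lambdaOneStar (Λ : Submodule ℤ (Fin 2 → ℝ)) : ℝ :=
  sInf {r : ℝ | ∃ v ∈ Λ, v 0 * v 1 ≠ 0 ∧ r = |v 0 * v 1|}

/-- The spectrum `𝒵`: the values of `lambdaOneStar` on unimodular rational lattices. -/
def zarembaSpectrum : Set ℝ :=
  {r : ℝ | ∃ Λ : Submodule ℤ (Fin 2 → ℝ),
    IsUnimodularLattice Λ ∧ IsRationalLattice Λ ∧ r = lambdaOneStar Λ}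

/-- A Markoff number: an entry of a solution of `x² + y² + z² = 3xyz` in positive integers. -/
def IsMarkoffNumber (m : ℕ) : Prop :=
  ∃ y z : ℕ, 0 < m ∧ 0 < y ∧ 0 < z ∧ m ^ 2 + y ^ 2 + z ^ 2 = 3 * m * y * z

/-- The number `2m / (√(9m² - 4) + 3m)`. -/
noncomputable def markoffLimit (m : ℕ) : ℝ :=
  2 * (m : ℝ) / (√(9 * (m : ℝ) ^ 2 - 4) + 3 * (m : ℝ))

/-!
The product of coordinates on a unimodular rational lattice is, in a suitable basis, the form
`± v (s v - u)` with a rational number `s` (`zarembaSpectrum_eq`). So the spectrum consists of the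
approximation constants `min q² |s - p / q|` (over `p / q ≠ s`) of the rational numbers `s`, and the
theorem is about the rational numbers which are badly approximable by all others, up to the constant
`1 / 3`. In hyperbolic terms: the geodesics of the modular torus which run from the cusp to the cusp
and stay low in between.

Such numbers are found in the tree of Markoff fractions `p / m`, where `m` is a Markoff number
(`MarkoffNode`). Suppose that `s` lies between two neighbouring Markoff fractions `a` and `b`, and
that its constant is larger than `1 / 3`. Then the smaller one of the two denominators is bounded
(`MarkoffNode.denominator_le`). Let `a = p / m` be the fraction with the smaller denominator. Going
through the Markoff fractions between `a` and `b` which are neighbours of `a`, one meets `s` itself,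
or finds `s` between two of them (or `b`), whose denominators are larger than `m`, or finds that the
distance from `s` to `a` is less than `markoffLimit m / m²`. In the last case `s` belongs to a
sequence of companions of `a` converging to `a + markoffLimit m / m²`, because the intervals of
radius `1 / (3 q²)` around the members of this sequence, where `q` is the denominator, cover
everything else (`MarkoffNode.exists_eq_companion`).

The constants of these numbers are computed exactly (`MarkoffNode.sInf_zarembaValues` and
`MarkoffNode.sInf_zarembaValues_companion`). The upper bounds are immediate; the lower bounds come
from `MarkoffTriple.mul_le_wedge_mul_wedge`: unfolding the modular torus, triangulated by three
disjoint geodesics belonging to a Markoff triple, gives a triangulation of the hyperbolic plane by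
ideal triangles, and the angle under which a rational point sees an edge is maximal when this point
is the third vertex of a triangle at this edge. For fixed `m` the constants of the Markoff fractions
next to `p / m` converge to `markoffLimit m` from above and those of the companions from below, and
for growing `m` they converge to `1 / 3`. So there are no limit points above `1 / 3` except the
numbers `markoffLimit m`, and these are limit points.
-/

/-! ### Rational lattices and rational numbers -/

/-- The nonzero values `|v (s v - u)|` of the form attached to the real number `s`, with `u`, `v`
integers. Up to sign this is the product of coordinates on the lattice spanned by `(1, s)` and
`(0, 1)`. -/
def zarembaValues (s : ℝ) : Set ℝ :=
  {r | ∃ u v : ℤ, (v : ℝ) * (s * v - u) ≠ 0 ∧ r = |(v : ℝ) * (s * v - u)|}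

lemma mem_zarembaValues_of_int {s : ℝ} (u v : ℤ) (h : (v : ℝ) * (s * v - u) ≠ 0) :
    |(v : ℝ) * (s * v - u)| ∈ zarembaValues s := ⟨u, v, h, rfl⟩

lemma zarembaValues_bddBelow (s : ℝ) : BddBelow (zarembaValues s) := by
  refine ⟨0, ?_⟩
  rintro r ⟨u, v, -, rfl⟩
  exact abs_nonneg _

lemma zarembaValues_neg (s : ℝ) : zarembaValues (-s) = zarembaValues s := by
  have key : ∀ t : ℝ, zarembaValues (-t) ⊆ zarembaValues t := by
    rintro t r ⟨u, v, h, rfl⟩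
    refine ⟨-u, v, ?_, ?_⟩
    · intro h0
      apply h
      push_cast at h0
      linear_combination -h0
    · rw [← abs_neg]
      congr 1
      push_cast
      ring
  refine Subset.antisymm (key s) ?_
  simpa using key (-s)

lemma zarembaValues_sub_int (s : ℝ) (n : ℤ) : zarembaValues (s - n) = zarembaValues s := by
  have key : ∀ (t : ℝ) (n : ℤ), zarembaValues (t - n) ⊆ zarembaValues t := by
    rintro t n r ⟨u, v, h, rfl⟩
    have e : (v : ℝ) * ((t - n) * v - u) = v * (t * v - ((n * v + u : ℤ) : ℝ)) := by
      push_cast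
      ring
    exact ⟨n * v + u, v, by rwa [← e], by rw [e]⟩
  refine Subset.antisymm (key s n) ?_
  have := key (s - n) (-n)
  simpa using this

lemma zsmul_apply_coord (n : ℤ) (w : Fin 2 → ℝ) (i : Fin 2) : (n • w) i = n * w i := by
  rw [Pi.smul_apply, zsmul_eq_mul]

lemma lambdaOneStar_eq_of_basis {Λ : Submodule ℤ (Fin 2 → ℝ)} {e₁ e₂ : Fin 2 → ℝ}
    (hΛ : ∀ w, w ∈ Λ ↔ ∃ u v : ℤ, w = u • e₁ + v • e₂) {s : ℝ} (h0 : e₁ 0 = 0)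
    (hdet : |e₂ 0 * e₁ 1| = 1) (hs : e₂ 1 = s * e₁ 1) :
    lambdaOneStar Λ = sInf (zarembaValues s) := by
  have hne : e₂ 0 * e₁ 1 ≠ 0 := by
    intro h
    rw [h] at hdet
    simp at hdet
  have e : ∀ u v : ℤ, (u • e₁ + v • e₂) 0 * (u • e₁ + v • e₂) 1
      = (e₂ 0 * e₁ 1) * (v * (s * v - ((-u : ℤ) : ℝ))) := by
    intro u v
    simp only [Pi.add_apply, zsmul_apply_coord, h0, hs]
    push_cast
    ring
  unfold lambdaOneStar
  congr 1
  ext r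
  constructor
  · rintro ⟨w, hw, hne', rfl⟩
    obtain ⟨u, v, rfl⟩ := (hΛ w).1 hw
    rw [e] at hne' ⊢
    refine ⟨-u, v, right_ne_zero_of_mul hne', ?_⟩
    rw [abs_mul, hdet, one_mul]
  · rintro ⟨u, v, hne', rfl⟩
    refine ⟨(-u) • e₁ + v • e₂, (hΛ _).2 ⟨-u, v, rfl⟩, ?_, ?_⟩
    · rw [e, neg_neg]
      exact mul_ne_zero hne hne'
    · rw [e, abs_mul (e₂ 0 * e₁ 1), hdet, one_mul, neg_neg]

/-- A unimodular rational lattice contains a primitive vector on the second coordinate axis; in a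
basis starting with it, the product of coordinates becomes `± v (s v - u)` with `s` rational. -/
lemma exists_rat_lambdaOneStar_eq {Λ : Submodule ℤ (Fin 2 → ℝ)} (hΛ : IsUnimodularLattice Λ)
    (hr : IsRationalLattice Λ) : ∃ s : ℚ, lambdaOneStar Λ = sInf (zarembaValues s) := by
  obtain ⟨hd, hz, hc⟩ := hΛ
  obtain ⟨d, hd0, hq⟩ := hr
  have hrank : Module.finrank ℤ Λ = 2 := by
    rw [ZLattice.rank ℝ Λ]
    simp
  have b : Module.Basis (Fin 2) ℤ Λ := Module.finBasisOfFinrankEq ℤ Λ hrank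
  rw [ZLattice.covolume_eq_det Λ b, Matrix.det_fin_two] at hc
  simp only [Matrix.of_apply, Function.comp_apply] at hc
  have hmem : ∀ w, w ∈ Λ ↔ ∃ i j : ℤ, w = i • (b 0 : Fin 2 → ℝ) + j • (b 1 : Fin 2 → ℝ) := by
    intro w
    constructor
    · intro hw
      refine ⟨b.repr ⟨w, hw⟩ 0, b.repr ⟨w, hw⟩ 1, ?_⟩
      have h2 := b.sum_repr ⟨w, hw⟩
      rw [Fin.sum_univ_two] at h2
      have h3 := congrArg Subtype.val h2
      simpa using h3.symm
    · rintro ⟨i, j, rfl⟩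
      exact add_mem (Λ.smul_mem i (b 0).2) (Λ.smul_mem j (b 1).2)
  set f := (b 0 : Fin 2 → ℝ) with hf
  set g := (b 1 : Fin 2 → ℝ) with hg
  obtain ⟨q00, h00⟩ := hq f (b 0).2 0
  obtain ⟨q01, h01⟩ := hq f (b 0).2 1
  obtain ⟨q10, h10⟩ := hq g (b 1).2 0
  obtain ⟨q11, h11⟩ := hq g (b 1).2 1
  -- the first coordinates of the basis vectors are in the ratio of two coprime integers
  obtain ⟨A, B, k, l, t, hkl, hA, hB⟩ : ∃ A B k l : ℤ, ∃ t : ℚ, A * k + B * l = 1 ∧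
      q00 = t * A ∧ q10 = t * B := by
    have hx : (q00 : ℚ) * (q00.den * q10.den) = ((q00.num * q10.den : ℤ) : ℚ) := by
      push_cast
      rw [← mul_assoc, Rat.mul_den_eq_num]
    have hy : (q10 : ℚ) * (q00.den * q10.den) = ((q10.num * q00.den : ℤ) : ℚ) := by
      push_cast
      rw [mul_comm (q00.den : ℚ), ← mul_assoc, Rat.mul_den_eq_num]
    have hN : ((q00.den : ℚ) * q10.den) ≠ 0 := by
      have := q00.den_ne_zero
      have := q10.den_ne_zero
      positivity
    have hne : q00.num * q10.den ≠ 0 ∨ q10.num * q00.den ≠ 0 := by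
      by_contra hcon
      push Not at hcon
      have h1 : q00 = 0 := by
        have := hcon.1
        rw [this] at hx
        simpa [q00.den_ne_zero, q10.den_ne_zero] using hx
      have h2 : q10 = 0 := by
        have := hcon.2
        rw [this] at hy
        simpa [q00.den_ne_zero, q10.den_ne_zero] using hy
      rw [h00, h10, h1, h2] at hc
      simp at hc
    obtain ⟨A, hA⟩ := Int.gcd_dvd_left (q00.num * q10.den) (q10.num * q00.den)
    obtain ⟨B, hB⟩ := Int.gcd_dvd_right (q00.num * q10.den) (q10.num * q00.den)
    have hbez := Int.gcd_eq_gcd_ab (q00.num * q10.den) (q10.num * q00.den)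
    have hg0 : ((Int.gcd (q00.num * q10.den) (q10.num * q00.den) : ℕ) : ℤ) ≠ 0 := by
      rw [Ne, Nat.cast_eq_zero, Int.gcd_eq_zero_iff]
      tauto
    generalize Int.gcdA (q00.num * q10.den) (q10.num * q00.den) = k at hbez
    generalize Int.gcdB (q00.num * q10.den) (q10.num * q00.den) = l at hbez
    generalize ((Int.gcd (q00.num * q10.den) (q10.num * q00.den) : ℕ) : ℤ) = G at *
    refine ⟨A, B, k, l, G / (q00.den * q10.den), ?_, ?_, ?_⟩
    · apply mul_left_cancel₀ hg0
      rw [hA, hB] at hbez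
      linear_combination -hbez
    · rw [div_mul_eq_mul_div, eq_div_iff hN, hx, hA]
      push_cast
      ring
    · rw [div_mul_eq_mul_div, eq_div_iff hN, hy, hB]
      push_cast
      ring
  have hklR : (A : ℝ) * k + B * l = 1 := by exact_mod_cast hkl
  have hX : √(d : ℝ) ≠ 0 := by
    have : (0 : ℝ) < d := by exact_mod_cast hd0
    positivity
  have hY : (B • f + (-A) • g) 0 = 0 := by
    simp only [Pi.add_apply, zsmul_apply_coord, h00, h10, hA, hB]
    push_cast
    ring
  have hdet' : |(k • f + l • g) 0 * (B • f + (-A) • g) 1| = 1 := by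
    rw [← hc, ← abs_neg]
    congr 1
    simp only [Pi.add_apply, zsmul_apply_coord, h00, h10, hA, hB]
    push_cast
    linear_combination (√(d : ℝ) * t * (A * g 1 - B * f 1)) * hklR
  have hq1 : B * q01 - A * q11 ≠ 0 := by
    intro h0
    have h1 : (B • f + (-A) • g) 1 = 0 := by
      simp only [Pi.add_apply, zsmul_apply_coord, h01, h11]
      have : (B : ℝ) * q01 - A * q11 = 0 := by exact_mod_cast h0
      push_cast
      linear_combination √(d : ℝ) * this
    rw [h1] at hdet'
    simp at hdet'
  refine ⟨(k * q01 + l * q11) / (B * q01 - A * q11),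
    lambdaOneStar_eq_of_basis (e₁ := B • f + (-A) • g) (e₂ := k • f + l • g) ?_ hY hdet' ?_⟩
  · intro w
    rw [hmem]
    constructor
    · rintro ⟨i, j, rfl⟩
      refine ⟨i * l - j * k, i * A + j * B, ?_⟩
      ext c
      simp only [Pi.add_apply, zsmul_apply_coord]
      push_cast
      linear_combination -(i * f c + j * g c) * hklR
    · rintro ⟨u, v, rfl⟩
      refine ⟨u * B + v * k, -(u * A) + v * l, ?_⟩
      ext c
      simp only [Pi.add_apply, zsmul_apply_coord]
      push_cast
      ring
  · have hq1R : (B : ℝ) * q01 - A * q11 ≠ 0 := by exact_mod_cast hq1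
    simp only [Pi.add_apply, zsmul_apply_coord, h01, h11]
    push_cast
    rw [div_mul_eq_mul_div, eq_div_iff hq1R]
    ring

/-- The lattice spanned by `(0, 1)` and `(1, s)`. -/
lemma exists_lattice_lambdaOneStar_eq (s : ℚ) : ∃ Λ : Submodule ℤ (Fin 2 → ℝ),
    IsUnimodularLattice Λ ∧ IsRationalLattice Λ ∧ lambdaOneStar Λ = sInf (zarembaValues s) := by
  have hli : LinearIndependent ℝ ![![(0 : ℝ), 1], ![1, (s : ℝ)]] := by
    rw [LinearIndependent.pair_iff]
    intro x y h
    have h0 := congrFun h 0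
    have h1 := congrFun h 1
    simp at h0 h1
    subst h0
    simpa using h1
  let e := basisOfLinearIndependentOfCardEqFinrank hli (by simp)
  have he : ∀ i, e i = ![![(0 : ℝ), 1], ![1, (s : ℝ)]] i := by
    intro i
    simp [e]
  have hmem : ∀ w, w ∈ Submodule.span ℤ (Set.range e) ↔
      ∃ u v : ℤ, w = u • ![(0 : ℝ), 1] + v • ![1, (s : ℝ)] := by
    intro w
    have hr : Set.range e = {![(0 : ℝ), 1], ![1, (s : ℝ)]} := by
      ext z
      simp only [Set.mem_range, Fin.exists_fin_two, he, Set.mem_insert_iff, Set.mem_singleton_iff]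
      simp [eq_comm]
    rw [hr, Submodule.mem_span_pair]
    simp only [eq_comm]
  refine ⟨Submodule.span ℤ (Set.range e), ⟨inferInstance, inferInstance, ?_⟩, ?_, ?_⟩
  · rw [ZLattice.covolume_eq_measure_fundamentalDomain _ _ (ZSpan.isAddFundamentalDomain e volume),
      ZSpan.volume_real_fundamentalDomain, Matrix.det_fin_two]
    simp [he]
  · refine ⟨1, one_pos, fun w hw i => ?_⟩
    obtain ⟨u, v, rfl⟩ := (hmem w).1 hw
    fin_cases i
    · exact ⟨v, by simp⟩
    · exact ⟨u + v * s, by simp⟩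
  · exact lambdaOneStar_eq_of_basis hmem (by simp) (by simp) (by simp)

lemma zarembaSpectrum_eq : zarembaSpectrum = {r | ∃ s : ℚ, r = sInf (zarembaValues s)} := by
  ext r
  constructor
  · rintro ⟨Λ, h1, h2, rfl⟩
    exact exists_rat_lambdaOneStar_eq h1 h2
  · rintro ⟨s, rfl⟩
    obtain ⟨Λ, h1, h2, h3⟩ := exists_lattice_lambdaOneStar_eq s
    exact ⟨Λ, h1, h2, h3.symm⟩

/-! ### Markoff triples -/

/-- A positive, pairwise coprime solution of Markoff's equation. -/
structure MarkoffTriple (x y z : ℤ) : Prop where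
  pos₁ : 0 < x
  pos₂ : 0 < y
  pos₃ : 0 < z
  eq : x ^ 2 + y ^ 2 + z ^ 2 = 3 * x * y * z
  coprime₁₂ : IsCoprime x y
  coprime₂₃ : IsCoprime y z
  coprime₁₃ : IsCoprime x z

namespace MarkoffTriple

variable {x y z : ℤ}

lemma swap (h : MarkoffTriple x y z) : MarkoffTriple y x z :=
  ⟨h.pos₂, h.pos₁, h.pos₃, by linear_combination h.eq, h.coprime₁₂.symm, h.coprime₁₃, h.coprime₂₃⟩

lemma rotate (h : MarkoffTriple x y z) : MarkoffTriple y z x :=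
  ⟨h.pos₂, h.pos₃, h.pos₁, by linear_combination h.eq, h.coprime₂₃, h.coprime₁₃.symm,
    h.coprime₁₂.symm⟩

lemma vieta_pos (h : MarkoffTriple x y z) : 0 < 3 * x * y - z := by
  have h1 : z * (3 * x * y - z) = x ^ 2 + y ^ 2 := by linear_combination -h.eq
  have h2 := h.pos₁
  have h3 : 0 < z * (3 * x * y - z) := by rw [h1]; positivity
  exact pos_of_mul_pos_right h3 h.pos₃.le

/-- The other root of Markoff's equation in the last variable. -/
lemma vieta (h : MarkoffTriple x y z) : MarkoffTriple x y (3 * x * y - z) := by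
  refine ⟨h.pos₁, h.pos₂, h.vieta_pos, by linear_combination h.eq, h.coprime₁₂, ?_, ?_⟩
  · have := h.coprime₂₃.neg_right.add_mul_left_right (3 * x)
    rwa [show -z + y * (3 * x) = 3 * x * y - z by ring] at this
  · have := h.coprime₁₃.neg_right.add_mul_left_right (3 * y)
    rwa [show -z + x * (3 * y) = 3 * x * y - z by ring] at this

lemma isMarkoffNumber (h : MarkoffTriple x y z) : IsMarkoffNumber x.toNat := by
  obtain ⟨a, rfl⟩ := Int.eq_ofNat_of_zero_le h.pos₁.le
  obtain ⟨b, rfl⟩ := Int.eq_ofNat_of_zero_le h.pos₂.le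
  obtain ⟨c, rfl⟩ := Int.eq_ofNat_of_zero_le h.pos₃.le
  refine ⟨b, c, ?_, ?_, ?_, ?_⟩
  · exact_mod_cast h.pos₁
  · exact_mod_cast h.pos₂
  · exact_mod_cast h.pos₃
  · exact_mod_cast h.eq

end MarkoffTriple

/-! ### The number `markoffLimit m` -/

lemma markoffLimit_eq {m : ℕ} (hm : 0 < m) :
    markoffLimit m = m * (3 * m - √(9 * (m : ℝ) ^ 2 - 4)) / 2 := by
  have hm1 : (1 : ℝ) ≤ m := by exact_mod_cast hm
  have h0 : 0 ≤ 9 * (m : ℝ) ^ 2 - 4 := by nlinarith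
  have h1 := Real.sq_sqrt h0
  have h2 := Real.sqrt_nonneg (9 * (m : ℝ) ^ 2 - 4)
  unfold markoffLimit
  rw [div_eq_div_iff (by positivity) (by norm_num)]
  linear_combination (m : ℝ) * h1

/-- The quadratic equation of which `markoffLimit m` is the smaller root. -/
lemma markoffLimit_quadratic {m : ℕ} (hm : 0 < m) :
    markoffLimit m ^ 2 - 3 * (m : ℝ) ^ 2 * markoffLimit m + (m : ℝ) ^ 2 = 0 := by
  have hm1 : (1 : ℝ) ≤ m := by exact_mod_cast hm
  have h1 := Real.sq_sqrt (show 0 ≤ 9 * (m : ℝ) ^ 2 - 4 by nlinarith)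
  rw [markoffLimit_eq hm]
  linear_combination (m : ℝ) ^ 2 / 4 * h1

lemma markoffLimit_pos {m : ℕ} (hm : 0 < m) : 0 < markoffLimit m := by
  have hm1 : (0 : ℝ) < m := by exact_mod_cast hm
  unfold markoffLimit
  positivity

lemma markoffLimit_lt_half {m : ℕ} (hm : 0 < m) : markoffLimit m < 1 / 2 := by
  have hm1 : (1 : ℝ) ≤ m := by exact_mod_cast hm
  have h1 : (m : ℝ) < √(9 * (m : ℝ) ^ 2 - 4) := by
    apply Real.lt_sqrt_of_sq_lt
    nlinarith
  unfold markoffLimit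
  rw [div_lt_iff₀ (by linarith)]
  linarith

lemma one_third_lt_markoffLimit {m : ℕ} (hm : 0 < m) : 1 / 3 < markoffLimit m := by
  have hm1 : (0 : ℝ) < m := by exact_mod_cast hm
  have h := markoffLimit_quadratic hm
  have h1 := markoffLimit_pos hm
  have h2 : 0 < markoffLimit m ^ 2 := by positivity
  have h3 : 0 < (m : ℝ) ^ 2 := by positivity
  by_contra hc
  push Not at hc
  nlinarith

lemma irrational_markoffLimit {m : ℕ} (hm : 0 < m) : Irrational (markoffLimit m) := by
  have hs : Irrational √(9 * (m : ℝ) ^ 2 - 4) := by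
    have hcast : (9 * (m : ℝ) ^ 2 - 4) = ((9 * (m : ℤ) ^ 2 - 4 : ℤ) : ℝ) := by push_cast; ring
    rw [hcast, irrational_sqrt_intCast_iff]
    have hm1 : (1 : ℤ) ≤ m := by exact_mod_cast hm
    refine ⟨?_, by nlinarith⟩
    rintro ⟨k, hk⟩
    have h1 : (3 * m - |k|) * (3 * m + |k|) = 4 := by
      have : |k| * |k| = k * k := abs_mul_abs_self k
      linear_combination hk - this
    have h2 := abs_nonneg k
    have h3 : 0 < 3 * (m : ℤ) - |k| := by
      by_contra hc
      push Not at hc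
      nlinarith
    have h4 : 3 * (m : ℤ) + |k| ≤ 4 := by nlinarith
    have h5 : (m : ℤ) = 1 := by linarith
    rw [h5] at h1 h4
    have h6 : |k| ≤ 1 := by linarith
    nlinarith
  rintro ⟨q, hq⟩
  apply hs
  refine ⟨3 * m - 2 * q / m, ?_⟩
  have hm0 : (m : ℝ) ≠ 0 := by positivity
  have := markoffLimit_eq hm
  rw [← hq] at this
  push_cast
  rw [this]
  field_simp
  ring

/-- In a Markoff triple `(m, x, y)`, all the quotients of an entry by the product of the other two
are at most `1 / markoffLimit m`. -/
lemma MarkoffTriple.markoffLimit_mul_le {m : ℕ} {x y : ℤ} (h : MarkoffTriple m x y) :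
    markoffLimit m * m ≤ x * y ∧ markoffLimit m * x ≤ m * y ∧ markoffLimit m * y ≤ m * x := by
  have hm : 0 < m := by exact_mod_cast h.pos₁
  have hx : (1 : ℝ) ≤ x := by exact_mod_cast h.pos₂
  have hy : (1 : ℝ) ≤ y := by exact_mod_cast h.pos₃
  have hm1 : (1 : ℝ) ≤ m := by exact_mod_cast hm
  have he : (m : ℝ) ^ 2 + x ^ 2 + y ^ 2 = 3 * m * x * y := by exact_mod_cast h.eq
  have hq := markoffLimit_quadratic hm
  have hl0 := markoffLimit_pos hm
  have hl1 := markoffLimit_lt_half hm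
  set l := markoffLimit m
  -- the quadratic of `l` is negative at `my / x`
  have key : ∀ x y : ℝ, 1 ≤ x → 1 ≤ y → (m : ℝ) ^ 2 + x ^ 2 + y ^ 2 = 3 * m * x * y →
      l * x ≤ m * y := by
    intro x y hx hy he
    by_contra hc
    push Not at hc
    have h1 : (l * x - m * y) * (l * x + m * y - 3 * m ^ 2 * x) = (m : ℝ) ^ 4 := by
      linear_combination x ^ 2 * hq - (m : ℝ) ^ 2 * he
    have h3 : l * x + m * y - 3 * m ^ 2 * x < 0 := by
      have : x ≤ (m : ℝ) ^ 2 * x := le_mul_of_one_le_left (by linarith) (by nlinarith)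
      nlinarith
    have h4 := mul_neg_of_pos_of_neg (sub_pos.2 hc) h3
    have h5 : 0 < (m : ℝ) ^ 4 := by positivity
    linarith
  refine ⟨?_, key x y hx hy he, key y x hy hx (by linear_combination he)⟩
  by_cases hlt : (m : ℝ) ≤ x
  · nlinarith
  · push Not at hlt
    by_contra hc
    push Not at hc
    -- the quadratic of `l` is not positive at `xy / m` because `x < m`
    have hc' : x * y < l * m := hc
    have h1 : l * m + x * y - 3 * m ^ 2 * m < 0 := by nlinarith
    have h2 : (l * m - x * y) * (l * m + x * y - 3 * m ^ 2 * m)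
        = m ^ 2 * (x ^ 2 + y ^ 2) - (x * y) ^ 2 := by
      linear_combination (m : ℝ) ^ 2 * hq - (m : ℝ) ^ 2 * he
    have h3 := mul_neg_of_pos_of_neg (sub_pos.2 hc') h1
    have h4 : (x : ℝ) ^ 2 * y ^ 2 ≤ m ^ 2 * y ^ 2 := by gcongr
    nlinarith [sq_nonneg (m * x : ℝ)]

/-! ### Edges of a Markoff triangulation -/

/-- The determinant of two integer vectors, positive if the second has the larger slope
`p / q` when `(p, q)` is read as a fraction with positive denominator. -/
def wedge (a b : ℤ × ℤ) : ℤ := a.2 * b.1 - a.1 * b.2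

/-- An integer vector `a` which has coprime determinants with two vectors is primitive, so that
every integer vector parallel to it is an integer multiple. -/
lemma exists_eq_smul_of_wedge_eq_zero {a b c r : ℤ × ℤ} (hbc : IsCoprime (wedge a b) (wedge a c))
    (h : wedge a r = 0) : ∃ t : ℤ, r = t • a := by
  obtain ⟨u, v, huv⟩ := hbc
  unfold wedge at *
  refine ⟨(u * b.1 + v * c.1) * r.2 - (u * b.2 + v * c.2) * r.1, ?_⟩
  ext
  · simp only [Prod.smul_fst, smul_eq_mul]
    linear_combination -r.1 * huv + (u * b.1 + v * c.1) * h
  · simp only [Prod.smul_snd, smul_eq_mul]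
    linear_combination -r.2 * huv + (u * b.2 + v * c.2) * h

/-- Let `x`, `y`, `z` be a Markoff triple and consider the triangulation of the hyperbolic plane
by ideal triangles whose sides have `λ`-lengths `x`, `y`, `z`, as it is obtained by unfolding the
modular torus. If `l` times every entry of the triple is at most the product of the two other
entries, then every edge `ab` of the triangulation is seen from any other rational point `r` under
an angle (measured along horocycles) at most `1 / l`. Seen from the third vertex `d` of the
triangle on the side of `r` this is the assumption, and behind `d` it follows from the statement
for one of the other two sides of this triangle, which is seen under a larger angle. -/
theorem mul_wedge_le (l : ℝ) (n : ℕ) : ∀ x y z : ℤ, MarkoffTriple x y z →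
    l * x ≤ y * z → l * y ≤ x * z → l * z ≤ x * y →
    ∀ a b d r : ℤ × ℤ, wedge a b = z → z • d = y • a + x • b →
    0 < wedge a r → 0 < wedge r b → wedge a r * wedge r b * (x * y) ≤ n →
    l * z ≤ wedge a r * wedge r b := by
  induction n with
  | zero =>
    intro x y z h _ _ _ a b d r _ _ h1 h2 h3
    have hx := h.pos₁
    have hy := h.pos₂
    have : 0 < wedge a r * wedge r b * (x * y) := by positivity
    norm_num at h3
    omega
  | succ n ih =>
    intro x y z h hlx hly hlz a b d r hab hd har hrb hn
    have hx := h.pos₁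
    have hy := h.pos₂
    have hz := h.pos₃
    have hd1 : z * d.1 = y * a.1 + x * b.1 := congrArg Prod.fst hd
    have hd2 : z * d.2 = y * a.2 + x * b.2 := congrArg Prod.snd hd
    have had : wedge a d = x := by
      apply mul_left_cancel₀ hz.ne'
      unfold wedge at *
      linear_combination a.2 * hd1 - a.1 * hd2 + x * hab
    have hdb : wedge d b = y := by
      apply mul_left_cancel₀ hz.ne'
      unfold wedge at *
      linear_combination b.1 * hd2 - b.2 * hd1 + y * hab
    have hrd : z * wedge r d = x * wedge r b - y * wedge a r := by
      unfold wedge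
      linear_combination r.2 * hd1 - r.1 * hd2
    rcases lt_trichotomy (wedge r d) 0 with hlt | heq | hgt
    · have hdr : 0 < wedge d r := by
        have : wedge d r = -wedge r d := by unfold wedge; ring
        omega
      obtain ⟨k, hk⟩ : y ∣ x * d.1 + z * b.1 := by
        apply h.coprime₂₃.dvd_of_dvd_mul_left
        refine ⟨x * a.1 + (3 * x * z - y) * b.1, ?_⟩
        linear_combination x * hd1 + b.1 * h.eq
      obtain ⟨k', hk'⟩ : y ∣ x * d.2 + z * b.2 := by
        apply h.coprime₂₃.dvd_of_dvd_mul_left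
        refine ⟨x * a.2 + (3 * x * z - y) * b.2, ?_⟩
        linear_combination x * hd2 + b.2 * h.eq
      have hdr' : z * wedge d r = y * wedge a r - x * wedge r b := by
        have : wedge d r = -wedge r d := by unfold wedge; ring
        rw [this]
        linear_combination -hrd
      have hle := ih z x y h.rotate.rotate (by linarith) (by linarith) (by linarith) d b (k, k') r
        hdb (by ext <;> simp [hk, hk']) hdr hrb (by
          have e : wedge d r * wedge r b * (z * x) =
              wedge a r * wedge r b * (x * y) - x ^ 2 * wedge r b ^ 2 := by
            linear_combination (wedge r b * x) * hdr'
          have : 0 < x ^ 2 * wedge r b ^ 2 := by positivity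
          push_cast at hn
          omega)
      have e : (z : ℝ) * wedge d r = y * wedge a r - x * wedge r b := by exact_mod_cast hdr'
      have hzR : (0 : ℝ) < z := by exact_mod_cast hz
      have hyR : (0 : ℝ) < y := by exact_mod_cast hy
      have hxR : (0 : ℝ) < x := by exact_mod_cast hx
      have : y * (l * z) ≤ y * (wedge a r * wedge r b : ℝ) := by
        calc y * (l * z) = z * (l * y) := by ring
          _ ≤ z * (wedge d r * wedge r b) := by gcongr
          _ = y * (wedge a r * wedge r b) - x * wedge r b ^ 2 := by
              linear_combination (wedge r b : ℝ) * e
          _ ≤ _ := by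
              have : 0 ≤ (x : ℝ) * wedge r b ^ 2 := by positivity
              linarith
      exact le_of_mul_le_mul_left this hyR
    · obtain ⟨t, rfl⟩ := exists_eq_smul_of_wedge_eq_zero (a := d) (b := a) (c := b) (r := r) (by
        have : wedge d a = -x := by rw [← had]; unfold wedge; ring
        rw [this, hdb]
        exact h.coprime₁₂.neg_left) (by unfold wedge at *; linarith)
      have e1 : wedge a (t • d) = t * x := by
        rw [← had]; simp only [wedge, Prod.smul_fst, Prod.smul_snd, smul_eq_mul]; ring
      have e2 : wedge (t • d) b = t * y := by
        rw [← hdb]; simp only [wedge, Prod.smul_fst, Prod.smul_snd, smul_eq_mul]; ring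
      rw [e1] at har ⊢
      rw [e2]
      have ht : 0 < t := pos_of_mul_pos_left har hx.le
      have ht1 : (1 : ℝ) ≤ t := by exact_mod_cast ht
      have hxR : (0 : ℝ) < x := by exact_mod_cast hx
      have hyR : (0 : ℝ) < y := by exact_mod_cast hy
      push_cast
      calc l * z ≤ x * y := hlz
        _ = 1 * (x * y) := by ring
        _ ≤ (t * t) * (x * y) := by gcongr; nlinarith
        _ = _ := by ring
    · obtain ⟨k, hk⟩ : x ∣ z * a.1 + y * d.1 := by
        apply h.coprime₁₃.dvd_of_dvd_mul_left
        refine ⟨y * b.1 + (3 * y * z - x) * a.1, ?_⟩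
        linear_combination y * hd1 + a.1 * h.eq
      obtain ⟨k', hk'⟩ : x ∣ z * a.2 + y * d.2 := by
        apply h.coprime₁₃.dvd_of_dvd_mul_left
        refine ⟨y * b.2 + (3 * y * z - x) * a.2, ?_⟩
        linear_combination y * hd2 + a.2 * h.eq
      have hle := ih y z x h.rotate (by linarith) (by linarith) (by linarith) a d (k, k') r
        had (by ext <;> simp [hk, hk']) har hgt (by
          have e : wedge a r * wedge r d * (y * z) =
              wedge a r * wedge r b * (x * y) - y ^ 2 * wedge a r ^ 2 := by
            linear_combination (wedge a r * y) * hrd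
          have : 0 < y ^ 2 * wedge a r ^ 2 := by positivity
          push_cast at hn
          omega)
      have e : (z : ℝ) * wedge r d = x * wedge r b - y * wedge a r := by exact_mod_cast hrd
      have hzR : (0 : ℝ) < z := by exact_mod_cast hz
      have hyR : (0 : ℝ) < y := by exact_mod_cast hy
      have hxR : (0 : ℝ) < x := by exact_mod_cast hx
      have : x * (l * z) ≤ x * (wedge a r * wedge r b : ℝ) := by
        calc x * (l * z) = z * (l * x) := by ring
          _ ≤ z * (wedge a r * wedge r d) := by gcongr
          _ = x * (wedge a r * wedge r b) - y * wedge a r ^ 2 := by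
              linear_combination (wedge a r : ℝ) * e
          _ ≤ _ := by
              have : 0 ≤ (y : ℝ) * wedge a r ^ 2 := by positivity
              linarith
      exact le_of_mul_le_mul_left this hxR

/-- `mul_wedge_le` without the induction parameter. -/
lemma MarkoffTriple.mul_le_wedge_mul_wedge {l : ℝ} {x y z : ℤ} (h : MarkoffTriple x y z)
    (hx : l * x ≤ y * z) (hy : l * y ≤ x * z) (hz : l * z ≤ x * y) {a b d r : ℤ × ℤ}
    (hab : wedge a b = z) (hd : z • d = y • a + x • b) (har : 0 < wedge a r)
    (hrb : 0 < wedge r b) : l * z ≤ wedge a r * wedge r b :=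
  mul_wedge_le l (wedge a r * wedge r b * (x * y)).toNat x y z h hx hy hz a b d r hab hd har hrb
    (Int.self_le_toNat _)

lemma wedge_swap (a b : ℤ × ℤ) : wedge b a = -wedge a b := by
  unfold wedge
  ring

lemma wedge_smul_right (t : ℤ) (a b : ℤ × ℤ) : wedge a (t • b) = t * wedge a b := by
  simp only [wedge, Prod.smul_fst, Prod.smul_snd, smul_eq_mul]
  ring

lemma wedge_smul_left (t : ℤ) (a b : ℤ × ℤ) : wedge (t • a) b = t * wedge a b := by
  simp only [wedge, Prod.smul_fst, Prod.smul_snd, smul_eq_mul]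
  ring

lemma wedge_sub_right (a b c : ℤ × ℤ) : wedge a (b - c) = wedge a b - wedge a c := by
  simp only [wedge, Prod.fst_sub, Prod.snd_sub]
  ring

lemma wedge_sub_left (a b c : ℤ × ℤ) : wedge (a - b) c = wedge a c - wedge b c := by
  simp only [wedge, Prod.fst_sub, Prod.snd_sub]
  ring

lemma wedge_self (a : ℤ × ℤ) : wedge a a = 0 := by
  unfold wedge
  ring

/-- The three-term Plücker relation. -/
lemma wedge_mul_wedge (a b p r : ℤ × ℤ) :
    wedge a b * wedge p r = wedge r b * wedge p a + wedge a r * wedge p b := by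
  unfold wedge
  ring

/-- If `L` is a lower bound for the values attached to the rational number `p / q` and is attained,
it is their infimum. The values are written as determinants of `(p, q)` with integer vectors. -/
lemma sInf_zarembaValues_eq {c : ℤ × ℤ} (hc : 0 < c.2) {L : ℝ}
    (hlow : ∀ r : ℤ × ℤ, 0 < r.2 → wedge c r ≠ 0 → L * c.2 ≤ r.2 * |wedge c r|)
    {r₀ : ℤ × ℤ} (h0 : 0 < r₀.2) (hne : wedge c r₀ ≠ 0) (hat : r₀.2 * |wedge c r₀| = L * c.2) :
    sInf (zarembaValues (c.1 / c.2)) = L := by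
  have hcR : (0 : ℝ) < c.2 := by exact_mod_cast hc
  have e : ∀ u v : ℤ, (v : ℝ) * ((c.1 : ℝ) / c.2 * v - u) = -(v * wedge c (u, v)) / c.2 := by
    intro u v
    unfold wedge
    push_cast
    field_simp
    ring
  have e' : ∀ u v : ℤ,
      |(v : ℝ) * ((c.1 : ℝ) / c.2 * v - u)| = |(v : ℝ)| * |wedge c (u, v)| / c.2 := by
    intro u v
    rw [e, abs_div, abs_neg, abs_mul, abs_of_pos hcR, Int.cast_abs]
  refine IsLeast.csInf_eq ⟨⟨r₀.1, r₀.2, ?_, ?_⟩, ?_⟩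
  · rw [e]
    have h1 : (r₀.2 : ℝ) ≠ 0 := by exact_mod_cast h0.ne'
    have h2 : (wedge c (r₀.1, r₀.2) : ℝ) ≠ 0 := by exact_mod_cast hne
    exact div_ne_zero (neg_ne_zero.2 (mul_ne_zero h1 h2)) hcR.ne'
  · have h1 : (0 : ℝ) < r₀.2 := by exact_mod_cast h0
    rw [e', eq_div_iff hcR.ne', ← hat, abs_of_pos h1]
  · rintro r ⟨u, v, hr, rfl⟩
    rw [e', le_div_iff₀ hcR]
    rw [e] at hr
    have hv : v ≠ 0 := by
      rintro rfl
      simp at hr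
    have hw : wedge c (u, v) ≠ 0 := by
      intro h
      rw [h] at hr
      simp at hr
    rcases lt_or_gt_of_ne hv with hv | hv
    · have h1 : wedge c (-u, -v) = -wedge c (u, v) := by unfold wedge; ring
      have := hlow (-u, -v) (by simpa using hv) (by rw [h1]; simpa using hw)
      rw [h1, abs_neg] at this
      have hvR : (v : ℝ) < 0 := by exact_mod_cast hv
      rw [abs_of_neg hvR]
      simpa using this
    · have hvR : (0 : ℝ) < v := by exact_mod_cast hv
      rw [abs_of_pos hvR]
      exact hlow (u, v) hv hw

/-! ### Markoff fractions -/

/-- Three consecutive Markoff fractions `a < c < b` (written as pairs of numerator and denominator):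
their denominators form a Markoff triple, neighbours have the denominator of the third one as
determinant, and the denominator of `c` is the largest of the three by a margin. -/
structure MarkoffNode (a c b : ℤ × ℤ) : Prop where
  wedge_left : wedge a c = b.2
  wedge_right : wedge c b = a.2
  triple : MarkoffTriple a.2 b.2 c.2
  margin : 3 * a.2 * b.2 - c.2 ≤ a.2 ∨ 3 * a.2 * b.2 - c.2 ≤ b.2

namespace MarkoffNode

variable {a c b : ℤ × ℤ}

lemma two_mul_le (h : MarkoffNode a c b) : 2 * (a.2 * b.2) ≤ c.2 := by
  have h1 := h.triple.pos₁
  have h2 := h.triple.pos₂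
  have h3 : a.2 ≤ a.2 * b.2 := le_mul_of_one_le_right h1.le h2
  have h4 : b.2 ≤ a.2 * b.2 := le_mul_of_one_le_left h2.le h1
  rcases h.margin with h5 | h5 <;> linarith

lemma left_lt (h : MarkoffNode a c b) : a.2 < c.2 := by
  have h1 := h.triple.pos₁
  have h2 := h.triple.pos₂
  have h3 : a.2 ≤ a.2 * b.2 := le_mul_of_one_le_right h1.le h2
  linarith [h.two_mul_le]

lemma right_lt (h : MarkoffNode a c b) : b.2 < c.2 := by
  have h1 := h.triple.pos₁
  have h2 := h.triple.pos₂
  have h3 : b.2 ≤ a.2 * b.2 := le_mul_of_one_le_left h2.le h1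
  linarith [h.two_mul_le]

lemma wedge_outer (h : MarkoffNode a c b) : wedge a b = 3 * a.2 * b.2 - c.2 := by
  apply mul_left_cancel₀ h.triple.pos₃.ne'
  have h1 := h.wedge_left
  have h2 := h.wedge_right
  have h3 := h.triple.eq
  unfold wedge at *
  linear_combination a.2 * h2 + b.2 * h1 + h3

lemma leftChild (h : MarkoffNode a c b) : MarkoffNode a ((3 * a.2) • c - b) c where
  wedge_left := by
    rw [wedge_sub_right, wedge_smul_right, h.wedge_left, h.wedge_outer]
    ring
  wedge_right := by
    rw [wedge_sub_left, wedge_smul_left, wedge_self, wedge_swap c b, h.wedge_right]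
    ring
  triple := by
    simpa using h.triple.swap.rotate.vieta
  margin := by
    right
    have := h.right_lt
    simp only [Prod.snd_sub, Prod.smul_snd, smul_eq_mul]
    linarith

lemma rightChild (h : MarkoffNode a c b) : MarkoffNode c ((3 * b.2) • c - a) b where
  wedge_left := by
    rw [wedge_sub_right, wedge_smul_right, wedge_self, wedge_swap a c, h.wedge_left]
    ring
  wedge_right := by
    rw [wedge_sub_left, wedge_smul_left, h.wedge_right, h.wedge_outer]
    ring
  triple := by
    have := h.triple.rotate.vieta.swap
    simpa [mul_right_comm] using this
  margin := by
    left
    have := h.left_lt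
    simp only [Prod.snd_sub, Prod.smul_snd, smul_eq_mul]
    linarith

lemma reflect (h : MarkoffNode a c b) :
    MarkoffNode (-b.1, b.2) (-c.1, c.2) (-a.1, a.2) where
  wedge_left := by
    have := h.wedge_right
    unfold wedge at *
    linear_combination this
  wedge_right := by
    have := h.wedge_left
    unfold wedge at *
    linear_combination this
  triple := h.triple.swap
  margin := by
    have := h.margin
    rw [or_comm, mul_right_comm]
    exact this

lemma root : MarkoffNode (0, 1) (1, 2) (1, 1) where
  wedge_left := by norm_num [wedge]
  wedge_right := by norm_num [wedge]
  triple := ⟨by norm_num, by norm_num, by norm_num, by norm_num, by norm_num, by norm_num,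
    by norm_num⟩
  margin := by norm_num

/-- The middle fraction of a node: the geodesic from `∞` to `c` is an edge of the triangulation
belonging to the triple of denominators, with `a` and `b` as third vertices of the two adjacent
triangles, so that the infimum is attained at `a` and `b`. -/
lemma sInf_zarembaValues (h : MarkoffNode a c b) :
    sInf (zarembaValues (c.1 / c.2)) = a.2 * b.2 / c.2 := by
  have ha := h.triple.pos₁
  have hb := h.triple.pos₂
  have hc := h.triple.pos₃
  have haR : (0 : ℝ) < a.2 := by exact_mod_cast ha
  have hbR : (0 : ℝ) < b.2 := by exact_mod_cast hb
  have hcR : (0 : ℝ) < c.2 := by exact_mod_cast hc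
  have hacR : (a.2 : ℝ) ≤ c.2 := by exact_mod_cast h.left_lt.le
  have hbcR : (b.2 : ℝ) ≤ c.2 := by exact_mod_cast h.right_lt.le
  have hL : (a.2 * b.2 / c.2 : ℝ) * c.2 = a.2 * b.2 := by field_simp
  have hx : (a.2 * b.2 / c.2 : ℝ) * a.2 ≤ b.2 * c.2 := by
    rw [div_mul_eq_mul_div, div_le_iff₀ hcR]
    calc (a.2 * b.2 * a.2 : ℝ) = b.2 * (a.2 * a.2) := by ring
      _ ≤ b.2 * (c.2 * c.2) := by gcongr
      _ = _ := by ring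
  have hy : (a.2 * b.2 / c.2 : ℝ) * b.2 ≤ a.2 * c.2 := by
    rw [div_mul_eq_mul_div, div_le_iff₀ hcR]
    calc (a.2 * b.2 * b.2 : ℝ) = a.2 * (b.2 * b.2) := by ring
      _ ≤ a.2 * (c.2 * c.2) := by gcongr
      _ = _ := by ring
  have hac := h.wedge_left
  have hcb := h.wedge_right
  have hca : wedge c a = -b.2 := by rw [wedge_swap, hac]
  refine sInf_zarembaValues_eq hc ?_ (r₀ := a) ha (by omega) ?_
  · intro r hr hne
    rcases lt_or_gt_of_ne hne with hlt | hgt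
    · have hrc : 0 < wedge r c := by
        rw [wedge_swap]
        omega
      have h0r : wedge (-1, 0) r = r.2 := by simp [wedge]
      have := h.triple.mul_le_wedge_mul_wedge (l := a.2 * b.2 / c.2) hx hy hL.le
        (a := (-1, 0)) (b := c) (d := a) (r := r) (by simp [wedge])
        (by
          unfold wedge at hac
          ext
          · simp only [Prod.smul_fst, Prod.fst_add, smul_eq_mul]
            linear_combination -hac
          · simp only [Prod.smul_snd, Prod.snd_add, smul_eq_mul]
            ring) (by rwa [h0r]) hrc
      rw [h0r] at this
      rwa [abs_of_neg hlt, ← wedge_swap]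
    · have h0r : wedge r (1, 0) = r.2 := by simp [wedge]
      have := h.triple.mul_le_wedge_mul_wedge (l := a.2 * b.2 / c.2) hx hy hL.le
        (a := c) (b := (1, 0)) (d := b) (r := r) (by simp [wedge])
        (by
          unfold wedge at hcb
          ext
          · simp only [Prod.smul_fst, Prod.fst_add, smul_eq_mul]
            linear_combination hcb
          · simp only [Prod.smul_snd, Prod.snd_add, smul_eq_mul]
            ring) hgt (by rwa [h0r])
      rw [h0r, mul_comm (wedge c r : ℝ)] at this
      rwa [abs_of_pos hgt]
  · rw [hca, abs_neg, abs_of_pos hb, hL]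

end MarkoffNode

/-! ### Companions of a Markoff fraction -/

/-- The Lucas sequence `0, 1, 3M, 9M² - 1, …` with parameter `3M`. -/
def markoffLucas (M : ℤ) : ℕ → ℤ
  | 0 => 0
  | 1 => 1
  | n + 2 => 3 * M * markoffLucas M (n + 1) - markoffLucas M n

/-- The orbit `v₀ = ∞`, `v₁ = a`, `v₂`, … of `∞` under the hyperbolic element of the modular group
whose axis covers the closed geodesic disjoint from the geodesic from `∞` to the Markoff fraction
`a`. From `v₃` on its members are called the companions of `a`. The vector `v₀` is
`(-1, 0)` rather than `(1, 0)` in order that the slopes increase. -/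
def companion (a : ℤ × ℤ) : ℕ → ℤ × ℤ
  | 0 => (-1, 0)
  | 1 => a
  | n + 2 => (3 * a.2) • companion a (n + 1) - companion a n

section Lucas

variable {M : ℤ}

lemma markoffLucas_add_two (n : ℕ) :
    markoffLucas M (n + 2) = 3 * M * markoffLucas M (n + 1) - markoffLucas M n := rfl

lemma markoffLucas_succ_bounds (hM : 0 < M) (n : ℕ) :
    0 ≤ markoffLucas M n ∧ 2 * (M * markoffLucas M n) ≤ markoffLucas M (n + 1) ∧
      (n : ℤ) + 1 ≤ markoffLucas M (n + 1) := by
  induction n with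
  | zero => simp [markoffLucas]
  | succ n ih =>
    obtain ⟨h1, h2, h3⟩ := ih
    have h4 : markoffLucas M (n + 1) ≤ M * markoffLucas M (n + 1) :=
      le_mul_of_one_le_left (by omega) hM
    have h5 : markoffLucas M n ≤ M * markoffLucas M n := le_mul_of_one_le_left h1 hM
    have h6 : 3 * M * markoffLucas M (n + 1) = 3 * (M * markoffLucas M (n + 1)) := by ring
    rw [markoffLucas_add_two, h6]
    push_cast
    refine ⟨by omega, by omega, by omega⟩

lemma markoffLucas_nonneg (hM : 0 < M) (n : ℕ) : 0 ≤ markoffLucas M n :=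
  (markoffLucas_succ_bounds hM n).1

lemma lt_markoffLucas_succ (hM : 0 < M) (n : ℕ) : (n : ℤ) < markoffLucas M (n + 1) :=
  (markoffLucas_succ_bounds hM n).2.2

lemma markoffLucas_succ_pos (hM : 0 < M) (n : ℕ) : 0 < markoffLucas M (n + 1) := by
  have := lt_markoffLucas_succ hM n
  omega

lemma markoffLucas_invariant (n : ℕ) :
    markoffLucas M (n + 1) ^ 2 + markoffLucas M n ^ 2
      = 3 * M * markoffLucas M (n + 1) * markoffLucas M n + 1 := by
  induction n with
  | zero => simp [markoffLucas]
  | succ n ih =>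
    rw [markoffLucas_add_two]
    linear_combination ih

lemma markoffLucas_add (i n : ℕ) : markoffLucas M (i + n + 1)
    = markoffLucas M (i + 1) * markoffLucas M (n + 1) - markoffLucas M i * markoffLucas M n := by
  induction n using Nat.twoStepInduction with
  | zero => simp [markoffLucas]
  | one =>
    simp only [markoffLucas]
    ring
  | more n h1 h2 =>
    rw [show i + (n + 2) + 1 = (i + n + 1) + 2 by ring, markoffLucas_add_two, h1,
      show i + n + 1 + 1 = i + (n + 1) + 1 by ring, h2, markoffLucas_add_two,
      show n + 2 + 1 = (n + 1) + 2 by ring, markoffLucas_add_two]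
    linear_combination (-3 * M * markoffLucas M (i + 1)) * markoffLucas_add_two (M := M) n

end Lucas

section Companion

variable {a : ℤ × ℤ}

lemma companion_add_two (n : ℕ) :
    companion a (n + 2) = (3 * a.2) • companion a (n + 1) - companion a n := rfl

lemma companion_succ (n : ℕ) : companion a (n + 1) =
    (a.1 * markoffLucas a.2 (n + 1) + markoffLucas a.2 n, a.2 * markoffLucas a.2 (n + 1)) := by
  induction n using Nat.twoStepInduction with
  | zero => simp [companion, markoffLucas]
  | one =>
    simp only [companion, markoffLucas]
    ext <;> simp <;> ring
  | more n h1 h2 =>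
    rw [show n + 2 + 1 = (n + 1) + 2 by ring, companion_add_two, h1, h2]
    simp only [markoffLucas_add_two]
    ext <;> simp <;> ring

lemma wedge_companion_succ (n : ℕ) : wedge (companion a n) (companion a (n + 1)) = a.2 := by
  induction n with
  | zero => simp [companion, wedge]
  | succ n ih =>
    rw [companion_add_two, wedge_sub_right, wedge_smul_right, wedge_self, wedge_swap, ih]
    ring

lemma wedge_companion (i n : ℕ) :
    wedge (companion a i) (companion a (i + n)) = a.2 * markoffLucas a.2 n := by
  induction n using Nat.twoStepInduction with
  | zero => simp [wedge_self, markoffLucas]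
  | one => simp [wedge_companion_succ, markoffLucas]
  | more n h1 h2 =>
    rw [← add_assoc, companion_add_two, wedge_sub_right, wedge_smul_right, h1, add_assoc, h2,
      markoffLucas_add_two]
    ring

end Companion

lemma mul_markoffLucas_lt {m : ℕ} (hm : 0 < m) (n : ℕ) :
    (m : ℝ) * markoffLucas m n < markoffLimit m * markoffLucas m (n + 1) := by
  have hM : (0 : ℤ) < m := by exact_mod_cast hm
  obtain ⟨h1, h2, h3⟩ := markoffLucas_succ_bounds hM n
  have h0 := markoffLucas_succ_pos hM n
  have hq := markoffLimit_quadratic hm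
  have hl := markoffLimit_lt_half hm
  have hinv : (markoffLucas m (n + 1) : ℝ) ^ 2 + (markoffLucas m n : ℝ) ^ 2
      = 3 * m * markoffLucas m (n + 1) * markoffLucas m n + 1 := by
    exact_mod_cast markoffLucas_invariant (M := m) n
  have h1R : (0 : ℝ) ≤ markoffLucas m n := by exact_mod_cast h1
  have h2R : 2 * ((m : ℝ) * markoffLucas m n) ≤ markoffLucas m (n + 1) := by exact_mod_cast h2
  have h0R : (0 : ℝ) < markoffLucas m (n + 1) := by exact_mod_cast h0
  have hmR : (1 : ℝ) ≤ m := by exact_mod_cast hm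
  generalize (markoffLucas m n : ℝ) = u at *
  generalize (markoffLucas m (n + 1) : ℝ) = w at *
  have e : (markoffLimit m * w - m * u) * (3 * m ^ 2 * w - markoffLimit m * w - m * u) = m ^ 2 := by
    linear_combination (-w ^ 2) * hq + (m : ℝ) ^ 2 * hinv
  have h4 : 0 < 3 * (m : ℝ) ^ 2 * w - markoffLimit m * w - m * u := by
    have : w ≤ (m : ℝ) ^ 2 * w := le_mul_of_one_le_left h0R.le (by nlinarith)
    nlinarith
  have h5 : 0 < (markoffLimit m * w - m * u) *
      (3 * m ^ 2 * w - markoffLimit m * w - m * u) := by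
    rw [e]
    positivity
  linarith [pos_of_mul_pos_left h5 h4.le]

namespace MarkoffNode

variable {a c b : ℤ × ℤ}

lemma wedge_companion_zero (r : ℤ × ℤ) : wedge (companion a 0) r = r.2 := by
  simp [companion, wedge]

/-- The determinants of the companions with `b` together with the denominator of `a` are the Markoff
triples containing this denominator. -/
lemma triple_companion (h : MarkoffNode a c b) (i : ℕ) :
    MarkoffTriple a.2 (wedge (companion a i) b) (wedge (companion a (i + 1)) b) := by
  induction i with
  | zero =>
    rw [wedge_companion_zero]
    change MarkoffTriple a.2 b.2 (wedge a b)
    rw [h.wedge_outer]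
    exact h.triple.vieta
  | succ i ih =>
    rw [companion_add_two, wedge_sub_left, wedge_smul_left]
    exact ih.swap.rotate.vieta

/-- The apex opposite to `b` of the triangle with base `vᵢ vᵢ₊₁` is an integer vector. -/
lemma exists_smul_eq_companion (h : MarkoffNode a c b) (i : ℕ) : ∃ t : ℤ × ℤ,
    a.2 • t = wedge (companion a i) b • companion a i +
      wedge (companion a (i + 1)) b • companion a (i + 1) := by
  induction i with
  | zero =>
    refine ⟨(3 * b.2 * a.1 - c.1, wedge a b), ?_⟩
    have h1 := h.wedge_left
    have h2 := h.wedge_outer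
    rw [wedge_companion_zero]
    change _ = b.2 • ((-1, 0) : ℤ × ℤ) + wedge a b • a
    rw [h2]
    unfold wedge at h1
    ext
    · simp only [Prod.smul_fst, Prod.fst_add, smul_eq_mul]
      linear_combination -h1
    · simp only [Prod.smul_snd, Prod.snd_add, smul_eq_mul]
      ring
  | succ i ih =>
    obtain ⟨t, ht⟩ := ih
    rw [companion_add_two, wedge_sub_left, wedge_smul_left]
    generalize companion a i = v at *
    generalize companion a (i + 1) = w at *
    refine ⟨t + (9 * a.2 * wedge w b) • w - (3 * wedge w b) • v - (3 * wedge v b) • w, ?_⟩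
    have e1 := congrArg Prod.fst ht
    have e2 := congrArg Prod.snd ht
    ext
    · simp only [Prod.smul_fst, Prod.fst_add, Prod.fst_sub, smul_eq_mul] at e1 ⊢
      linear_combination e1
    · simp only [Prod.smul_snd, Prod.snd_add, Prod.snd_sub, smul_eq_mul] at e2 ⊢
      linear_combination e2

lemma sq_mul_markoffLucas_le (h : MarkoffNode a c b) {m : ℕ} (hm : a.2 = m) (j : ℕ) :
    (a.2 : ℝ) ^ 2 * markoffLucas a.2 j ≤ markoffLimit m * a.2 * markoffLucas a.2 (j + 1) := by
  have ha := h.triple.pos₁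
  have haR : (0 : ℝ) < a.2 := by exact_mod_cast ha
  have := (mul_markoffLucas_lt (m := m) (by omega) j).le
  rw [← hm, ← Int.cast_natCast (R := ℝ) m, ← hm] at this
  calc (a.2 : ℝ) ^ 2 * markoffLucas a.2 j = a.2 * (a.2 * markoffLucas a.2 j) := by ring
    _ ≤ a.2 * (markoffLimit m * markoffLucas a.2 (j + 1)) := by gcongr
    _ = _ := by ring

/-- Lower bound for the rational numbers below the companion `vⱼ₊₁`: such a number is one of the
earlier `vᵢ`, or it is separated from the geodesic `v₀ vⱼ₊₁` by one of the edges `vᵢ vᵢ₊₁`. -/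
lemma companion_lower_left (h : MarkoffNode a c b) {j : ℕ} {r : ℤ × ℤ} (hr : 0 < r.2)
    (hneg : 0 < wedge r (companion a (j + 1))) :
    a.2 ^ 2 * markoffLucas a.2 j ≤ r.2 * wedge r (companion a (j + 1)) := by
  have ha := h.triple.pos₁
  have hex : ∃ i, 0 ≤ wedge r (companion a (i + 1)) := ⟨j, hneg.le⟩
  classical
  obtain ⟨i, hi, hmin⟩ : ∃ i, 0 ≤ wedge r (companion a (i + 1)) ∧
      ∀ k < i, ¬ 0 ≤ wedge r (companion a (k + 1)) :=
    ⟨Nat.find hex, Nat.find_spec hex, fun k hk => Nat.find_min hex hk⟩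
  have hij : i ≤ j := by
    by_contra hc
    push Not at hc
    exact hmin j hc hneg.le
  obtain ⟨n, rfl⟩ := Nat.exists_eq_add_of_le hij
  have hpos : 0 < wedge (companion a i) r := by
    rcases i with _ | i
    · rwa [wedge_companion_zero]
    · rw [wedge_swap]
      have := hmin i (Nat.lt_succ_self i)
      omega
  have hUi := markoffLucas_nonneg ha i
  have hUn := markoffLucas_nonneg ha n
  have hUi1 := markoffLucas_succ_pos ha i
  have hUn1 := markoffLucas_succ_pos ha n
  have hv0 := wedge_companion (a := a) 0 i
  have hv1 := wedge_companion (a := a) 0 (i + 1)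
  have hw0 := wedge_companion (a := a) i (n + 1)
  have hw1 := wedge_companion (a := a) (i + 1) n
  rw [zero_add] at hv0 hv1
  rw [show i + (n + 1) = i + n + 1 by ring] at hw0
  rw [show i + 1 + n = i + n + 1 by ring] at hw1
  rw [← wedge_companion_zero (a := a) r]
  rcases hi.eq_or_lt with heq | hgt
  · have htr := h.triple_companion (i + 1)
    obtain ⟨t, rfl⟩ := exists_eq_smul_of_wedge_eq_zero (a := companion a (i + 1))
      (b := companion a (i + 1 + 1)) (c := b) (r := r)
      (by rw [wedge_companion_succ]; exact htr.coprime₁₂) (by rw [wedge_swap, ← heq, neg_zero])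
    rw [wedge_smul_right, hv1, wedge_smul_left, hw1]
    rw [wedge_smul_left, hw1] at hneg
    rcases n with _ | n
    · simp [markoffLucas] at hneg
    have hadd := markoffLucas_add (M := a.2) i n
    have hUn' := markoffLucas_nonneg ha n
    have ht : t ≠ 0 := by
      rintro rfl
      simp at hneg
    have ht2 : 1 ≤ t ^ 2 := by
      have := sq_pos_of_ne_zero ht
      omega
    calc a.2 ^ 2 * markoffLucas a.2 (i + (n + 1))
        ≤ 1 * (a.2 ^ 2 * (markoffLucas a.2 (i + 1) * markoffLucas a.2 (n + 1))) := by
          rw [← add_assoc, hadd, one_mul]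
          gcongr
          have := mul_nonneg hUi hUn'
          linarith
      _ ≤ t ^ 2 * (a.2 ^ 2 * (markoffLucas a.2 (i + 1) * markoffLucas a.2 (n + 1))) := by
          gcongr
      _ = _ := by ring
  · obtain ⟨m, hm⟩ := Int.eq_ofNat_of_zero_le ha.le
    have htr := h.triple_companion i
    obtain ⟨t, ht⟩ := h.exists_smul_eq_companion i
    have hm0 : 0 < m := by omega
    have hlam : markoffLimit m * a.2 ≤
        wedge (companion a i) r * wedge r (companion a (i + 1)) := by
      have htr' := htr
      rw [hm] at htr'
      obtain ⟨l1, l2, l3⟩ := htr'.markoffLimit_mul_le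
      have hmR : (a.2 : ℝ) = m := by exact_mod_cast hm
      refine htr.rotate.swap.mul_le_wedge_mul_wedge (d := t) ?_ ?_ ?_ (wedge_companion_succ i) ht
        hpos hgt
      · rw [hmR]; linarith
      · rw [hmR]; linarith
      · rw [hmR]; linarith
    -- the geodesic `v₀ vⱼ₊₁` is seen from `r` under a smaller angle than the edge `vᵢ vᵢ₊₁`
    have p1 : wedge (companion a 0) r = wedge r (companion a (i + 1)) * markoffLucas a.2 i +
        wedge (companion a i) r * markoffLucas a.2 (i + 1) := by
      apply mul_left_cancel₀ ha.ne'
      have := wedge_mul_wedge (companion a i) (companion a (i + 1)) (companion a 0) r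
      rw [wedge_companion_succ, hv0, hv1] at this
      linear_combination this
    have p2 : wedge r (companion a (i + n + 1)) =
        wedge r (companion a (i + 1)) * markoffLucas a.2 (n + 1) +
        wedge (companion a i) r * markoffLucas a.2 n := by
      apply mul_left_cancel₀ ha.ne'
      have := wedge_mul_wedge (companion a i) (companion a (i + 1)) r (companion a (i + n + 1))
      rw [wedge_companion_succ, wedge_swap (companion a (i + 1)) (companion a (i + n + 1)),
        wedge_swap (companion a i) r, hw0, hw1] at this
      linear_combination this
    rw [p1, p2]
    generalize wedge (companion a i) r = α at *
    generalize wedge r (companion a (i + 1)) = β at *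
    have hadd := markoffLucas_add (M := a.2) i n
    have h2 : α * β * markoffLucas a.2 (i + n + 1) ≤
        (β * markoffLucas a.2 i + α * markoffLucas a.2 (i + 1)) *
        (β * markoffLucas a.2 (n + 1) + α * markoffLucas a.2 n) := by
      rw [hadd]
      have q1 : 0 ≤ α * β * (markoffLucas a.2 i * markoffLucas a.2 n) := by positivity
      have q2 : 0 ≤ β ^ 2 * (markoffLucas a.2 i * markoffLucas a.2 (n + 1)) := by positivity
      have q3 : 0 ≤ α ^ 2 * (markoffLucas a.2 (i + 1) * markoffLucas a.2 n) := by positivity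
      linarith
    refine le_trans ?_ h2
    have hU : (0 : ℝ) ≤ markoffLucas a.2 (i + n + 1) := by
      exact_mod_cast markoffLucas_nonneg ha _
    exact_mod_cast (h.sq_mul_markoffLucas_le hm (i + n)).trans
      (mul_le_mul_of_nonneg_right hlam hU)

/-- Lower bound for the rational numbers above the companion `vⱼ₊₁`: such a number is `b`, or it
is separated from the geodesic `v₀ vⱼ₊₁` by one of the edges `vⱼ₊₁ b` and `b v₀`. -/
lemma companion_lower_right (h : MarkoffNode a c b) {j : ℕ} {r : ℤ × ℤ} (hr : 0 < r.2)
    (hpos : 0 < wedge (companion a (j + 1)) r) :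
    a.2 ^ 2 * markoffLucas a.2 j ≤ r.2 * wedge (companion a (j + 1)) r := by
  have ha := h.triple.pos₁
  have hb := h.triple.pos₂
  obtain ⟨m, hm⟩ := Int.eq_ofNat_of_zero_le ha.le
  have hm0 : 0 < m := by omega
  have hmR : (a.2 : ℝ) = m := by exact_mod_cast hm
  have hr0 : wedge r (1, 0) = r.2 := by simp [wedge]
  have hv0 := wedge_companion (a := a) 0 (j + 1)
  rw [zero_add] at hv0
  have hvk : wedge (companion a (j + 1)) (1, 0) = a.2 * markoffLucas a.2 (j + 1) := by
    rw [← hv0]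
    simp [companion, wedge]
  have htr := h.triple_companion (j + 1)
  have hX := htr.pos₂
  have hb0 : wedge b (1, 0) = b.2 := by simp [wedge]
  have hU := markoffLucas_nonneg ha j
  have hU1 := markoffLucas_succ_pos ha j
  have hXb : wedge (companion a (j + 1)) b * b.2 ≥ a.2 ^ 2 * markoffLucas a.2 j := by
    have hX1 : 0 < wedge a b := by
      rw [h.wedge_outer]
      exact h.triple.vieta_pos
    have hXe : ∀ i, wedge (companion a (i + 1)) b =
        markoffLucas a.2 (i + 1) * wedge a b - markoffLucas a.2 i * b.2 := by
      intro i
      rw [companion_succ]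
      unfold wedge
      ring
    have heq : a.2 ^ 2 + b.2 ^ 2 + wedge a b ^ 2 = 3 * a.2 * b.2 * wedge a b := by
      rw [h.wedge_outer]
      exact h.triple.vieta.eq
    have h1 : 0 ≤ markoffLucas a.2 (j + 1) * b.2 -
        markoffLucas a.2 j * (3 * a.2 * b.2 - wedge a b) := by
      rcases j with _ | i
      · simp [markoffLucas, hb.le]
      · have := (h.triple_companion i).pos₃
        rw [hXe] at this
        rw [markoffLucas_add_two]
        linarith
    have h2 := mul_nonneg hX1.le h1
    rw [hXe]
    have h3 : (markoffLucas a.2 (j + 1) * wedge a b - markoffLucas a.2 j * b.2) * b.2 -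
        a.2 ^ 2 * markoffLucas a.2 j = wedge a b * (markoffLucas a.2 (j + 1) * b.2 -
        markoffLucas a.2 j * (3 * a.2 * b.2 - wedge a b)) := by
      linear_combination (-markoffLucas a.2 j) * heq
    linarith
  have hbase := h.sq_mul_markoffLucas_le hm j
  have hUR : (0 : ℝ) < markoffLucas a.2 (j + 1) := by exact_mod_cast hU1
  have haR : (0 : ℝ) < a.2 := by exact_mod_cast ha
  have hbR : (0 : ℝ) < b.2 := by exact_mod_cast hb
  have hXR : (0 : ℝ) < wedge (companion a (j + 1)) b := by exact_mod_cast hX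
  rw [← hr0]
  rcases lt_trichotomy (wedge r b) 0 with hlt | heq | hgt
  · -- `r` lies between `b` and `v₀ = ∞`
    have hbr : 0 < wedge b r := by rw [wedge_swap]; omega
    have hlam : markoffLimit m * b.2 ≤ wedge b r * wedge r (1, 0) := by
      have ht := h.triple.swap.rotate
      have ht' := ht
      rw [hm] at ht'
      obtain ⟨l1, l2, l3⟩ := ht'.markoffLimit_mul_le
      have h1 := h.wedge_outer
      unfold wedge at h1
      refine h.triple.rotate.rotate.mul_le_wedge_mul_wedge (d := (3 * a.2 + a.1, a.2)) ?_ ?_ ?_ hb0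
        ?_ hbr (by rwa [hr0])
      · rw [hmR]; linarith
      · rw [hmR]; linarith
      · rw [hmR]; linarith
      · ext
        · simp only [Prod.smul_fst, Prod.fst_add, smul_eq_mul]
          linear_combination -h1
        · simp only [Prod.smul_snd, Prod.snd_add, smul_eq_mul]
          ring
    have hp := wedge_mul_wedge b (1, 0) (companion a (j + 1)) r
    rw [hb0, hvk] at hp
    generalize wedge (companion a (j + 1)) r = γ at *
    generalize wedge b r = α at *
    generalize wedge r (1, 0) = β at *
    have hpR : (b.2 : ℝ) * γ = β * wedge (companion a (j + 1)) b +
        α * (a.2 * markoffLucas a.2 (j + 1)) := by exact_mod_cast hp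
    have : (b.2 : ℝ) * (a.2 ^ 2 * markoffLucas a.2 j) ≤ b.2 * (β * γ) := by
      calc (b.2 : ℝ) * (a.2 ^ 2 * markoffLucas a.2 j)
          ≤ b.2 * (markoffLimit m * a.2 * markoffLucas a.2 (j + 1)) := by gcongr
        _ = (markoffLimit m * b.2) * (a.2 * markoffLucas a.2 (j + 1)) := by ring
        _ ≤ (α * β) * (a.2 * markoffLucas a.2 (j + 1)) := by gcongr
        _ = b.2 * (β * γ) - β ^ 2 * wedge (companion a (j + 1)) b := by
            linear_combination (-β : ℝ) * hpR
        _ ≤ _ := by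
            have : 0 ≤ (β : ℝ) ^ 2 * wedge (companion a (j + 1)) b := by positivity
            linarith
    exact_mod_cast le_of_mul_le_mul_left this hbR
  · obtain ⟨t, rfl⟩ := exists_eq_smul_of_wedge_eq_zero (a := b) (b := (1, 0)) (c := c) (r := r)
      (by
        rw [hb0, wedge_swap, h.wedge_right]
        exact h.triple.coprime₁₂.symm.neg_right) (by rw [wedge_swap, heq, neg_zero])
    rw [wedge_smul_right, wedge_smul_left, hb0]
    simp only [Prod.smul_snd, smul_eq_mul] at hr
    have ht : 0 < t := pos_of_mul_pos_left hr hb.le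
    have ht2 : 1 ≤ t ^ 2 := by
      have := sq_pos_of_pos ht
      omega
    calc a.2 ^ 2 * markoffLucas a.2 j ≤ 1 * (wedge (companion a (j + 1)) b * b.2) := by
          linarith
      _ ≤ t ^ 2 * (wedge (companion a (j + 1)) b * b.2) := by gcongr
      _ = _ := by ring
  · have hlam : markoffLimit m * wedge (companion a (j + 1)) b ≤
        wedge (companion a (j + 1)) r * wedge r b := by
      have ht' := htr
      rw [hm] at ht'
      obtain ⟨l1, l2, l3⟩ := ht'.markoffLimit_mul_le
      refine htr.swap.rotate.mul_le_wedge_mul_wedge (d := companion a (j + 1 + 1)) ?_ ?_ ?_ rfl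
        ?_ hpos hgt
      · rw [hmR]; linarith
      · rw [hmR]; linarith
      · rw [hmR]; linarith
      · rw [← wedge_companion_succ (a := a) (j + 1)]
        unfold wedge
        ext
        · simp only [Prod.smul_fst, Prod.fst_add, smul_eq_mul]
          ring
        · simp only [Prod.smul_snd, Prod.snd_add, smul_eq_mul]
          ring
    have hp := wedge_mul_wedge (companion a (j + 1)) b (1, 0) r
    rw [wedge_swap r, wedge_swap (companion a (j + 1)) (1, 0), wedge_swap b (1, 0), hb0, hvk] at hp
    generalize wedge (companion a (j + 1)) r = α at *
    generalize wedge r b = β at *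
    generalize wedge r (1, 0) = γ at *
    have hpR : (wedge (companion a (j + 1)) b : ℝ) * γ =
        β * (a.2 * markoffLucas a.2 (j + 1)) + α * b.2 := by
      have : wedge (companion a (j + 1)) b * γ =
        β * (a.2 * markoffLucas a.2 (j + 1)) + α * b.2 := by linear_combination -hp
      exact_mod_cast this
    generalize (wedge (companion a (j + 1)) b : ℝ) = X at *
    have : X * (a.2 ^ 2 * markoffLucas a.2 j) ≤ X * (γ * α) := by
      calc X * (a.2 ^ 2 * markoffLucas a.2 j)
          ≤ X * (markoffLimit m * a.2 * markoffLucas a.2 (j + 1)) := by gcongr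
        _ = (markoffLimit m * X) * (a.2 * markoffLucas a.2 (j + 1)) := by ring
        _ ≤ (α * β) * (a.2 * markoffLucas a.2 (j + 1)) := by gcongr
        _ = X * (γ * α) - α ^ 2 * b.2 := by linear_combination (-α : ℝ) * hpR
        _ ≤ _ := by
            have : 0 ≤ (α : ℝ) ^ 2 * b.2 := by positivity
            linarith
    exact_mod_cast le_of_mul_le_mul_left this hXR

lemma sInf_zarembaValues_companion (h : MarkoffNode a c b) {j : ℕ} (hj : 0 < j) :
    sInf (zarembaValues ((companion a (j + 1)).1 / (companion a (j + 1)).2)) =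
      a.2 * markoffLucas a.2 j / markoffLucas a.2 (j + 1) := by
  have ha := h.triple.pos₁
  have hU1 := markoffLucas_succ_pos ha j
  have hU : 0 < markoffLucas a.2 j := by
    obtain ⟨i, rfl⟩ := Nat.exists_eq_succ_of_ne_zero hj.ne'
    exact markoffLucas_succ_pos ha i
  have hU1R : (markoffLucas a.2 (j + 1) : ℝ) ≠ 0 := by exact_mod_cast hU1.ne'
  have h2 : (companion a (j + 1)).2 = a.2 * markoffLucas a.2 (j + 1) := by rw [companion_succ]
  have hL : (a.2 * markoffLucas a.2 j / markoffLucas a.2 (j + 1) : ℝ) *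
      (companion a (j + 1)).2 = ((a.2 ^ 2 * markoffLucas a.2 j : ℤ) : ℝ) := by
    rw [h2]
    push_cast
    field_simp
  have hw : wedge (companion a (j + 1)) a = -(a.2 * markoffLucas a.2 j) := by
    rw [wedge_swap, ← wedge_companion (a := a) 1 j, add_comm 1 j]
    rfl
  have hpos : 0 < a.2 * markoffLucas a.2 j := by positivity
  refine sInf_zarembaValues_eq (by rw [h2]; positivity) ?_ (r₀ := a) ha (by omega) ?_
  · intro r hr hne
    rw [hL]
    rcases lt_or_gt_of_ne hne with hlt | hgt
    · rw [abs_of_neg hlt, ← wedge_swap]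
      exact_mod_cast h.companion_lower_left hr (by rw [wedge_swap]; omega)
    · rw [abs_of_pos hgt]
      exact_mod_cast h.companion_lower_right hr hgt
  · rw [hL, hw, abs_neg, abs_of_pos hpos]
    push_cast
    ring

end MarkoffNode

/-! ### Convergence to `markoffLimit m` -/

lemma markoffLimit_sub_markoffLucas_le {m : ℕ} (hm : 0 < m) (n : ℕ) :
    (markoffLimit m * markoffLucas m (n + 1) - m * markoffLucas m n) * markoffLucas m (n + 1)
      ≤ 1 := by
  have hM : (0 : ℤ) < m := by exact_mod_cast hm
  obtain ⟨h1, h2, h3⟩ := markoffLucas_succ_bounds hM n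
  have hlt := mul_markoffLucas_lt hm n
  have h0 := markoffLucas_succ_pos hM n
  have hq := markoffLimit_quadratic hm
  have hl := markoffLimit_lt_half hm
  have hinv : (markoffLucas m (n + 1) : ℝ) ^ 2 + (markoffLucas m n : ℝ) ^ 2
      = 3 * m * markoffLucas m (n + 1) * markoffLucas m n + 1 := by
    exact_mod_cast markoffLucas_invariant (M := m) n
  have h2R : 2 * ((m : ℝ) * markoffLucas m n) ≤ markoffLucas m (n + 1) := by exact_mod_cast h2
  have h0R : (0 : ℝ) < markoffLucas m (n + 1) := by exact_mod_cast h0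
  have hmR : (1 : ℝ) ≤ m := by exact_mod_cast hm
  generalize (markoffLucas m n : ℝ) = u at *
  generalize (markoffLucas m (n + 1) : ℝ) = w at *
  have e : (markoffLimit m * w - m * u) * (3 * m ^ 2 * w - markoffLimit m * w - m * u) = m ^ 2 := by
    linear_combination (-w ^ 2) * hq + (m : ℝ) ^ 2 * hinv
  have h4 : (m : ℝ) ^ 2 * w ≤ 3 * (m : ℝ) ^ 2 * w - markoffLimit m * w - m * u := by
    have : w ≤ (m : ℝ) ^ 2 * w := le_mul_of_one_le_left h0R.le (by nlinarith)
    nlinarith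
  have h5 := mul_le_mul_of_nonneg_left h4 (sub_pos.2 hlt).le
  rw [e] at h5
  have h6 : (0 : ℝ) < (m : ℝ) ^ 2 := by positivity
  refine le_of_mul_le_mul_left ?_ h6
  linarith

/-- For a Markoff triple `(m, y, z)` with large `z` the value `my / z` is slightly larger than
`markoffLimit m`. -/
lemma MarkoffTriple.sub_markoffLimit {m : ℕ} {y z : ℤ} (h : MarkoffTriple m y z)
    (hz : 2 * (m * y) ≤ z) : markoffLimit m < m * y / z ∧
      ((m * y / z : ℝ) - markoffLimit m) * z ^ 2 ≤ m ^ 2 := by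
  have hm : 0 < m := by exact_mod_cast h.pos₁
  have hyR : (1 : ℝ) ≤ y := by exact_mod_cast h.pos₂
  have hzR : (0 : ℝ) < z := by exact_mod_cast h.pos₃
  have hmR : (1 : ℝ) ≤ m := by exact_mod_cast hm
  have he : (m : ℝ) ^ 2 + y ^ 2 + z ^ 2 = 3 * m * y * z := by exact_mod_cast h.eq
  have hz' : 2 * ((m : ℝ) * y) ≤ z := by exact_mod_cast hz
  have hq := markoffLimit_quadratic hm
  have hl := markoffLimit_lt_half hm
  set v : ℝ := m * y / z with hv
  have hvz : v * z = m * y := by rw [hv]; field_simp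
  have hv2 : v ≤ 1 / 2 := by
    rw [hv, div_le_iff₀ hzR]
    linarith
  have e : (v - markoffLimit m) * (3 * m ^ 2 - v - markoffLimit m) * z ^ 2 = m ^ 4 := by
    linear_combination (z : ℝ) ^ 2 * hq - (m : ℝ) ^ 2 * he +
      (3 * (m : ℝ) ^ 2 * z - v * z - m * y) * hvz
  have h1 : (m : ℝ) ^ 2 ≤ 3 * m ^ 2 - v - markoffLimit m := by nlinarith
  have h2 : (0 : ℝ) < m ^ 2 := by positivity
  have h3 : 0 < v - markoffLimit m := by
    have : 0 < (v - markoffLimit m) * ((3 * m ^ 2 - v - markoffLimit m) * z ^ 2) := by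
      rw [← mul_assoc, e]
      positivity
    exact pos_of_mul_pos_left this (by have := h2.trans_le h1; positivity)
  refine ⟨by linarith, ?_⟩
  have h4 : (m : ℝ) ^ 2 * ((v - markoffLimit m) * z ^ 2) ≤ (m : ℝ) ^ 2 * (m : ℝ) ^ 2 := by
    calc (m : ℝ) ^ 2 * ((v - markoffLimit m) * z ^ 2)
        ≤ (3 * m ^ 2 - v - markoffLimit m) * ((v - markoffLimit m) * z ^ 2) := by
          gcongr
      _ = (m : ℝ) ^ 2 * (m : ℝ) ^ 2 := by linear_combination e
  exact le_of_mul_le_mul_left h4 h2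

/-! ### Classification of the rational numbers with large values -/

lemma le_mul_sub_of_lt {s t : ℝ} (hs : ∀ r ∈ zarembaValues s, t ≤ r) {r : ℤ × ℤ} (hr : 0 < r.2)
    (h : r.1 < r.2 * s) : t ≤ r.2 * (r.2 * s - r.1) := by
  have hrR : (0 : ℝ) < r.2 := by exact_mod_cast hr
  have h1 : 0 < (r.2 : ℝ) * (s * r.2 - r.1) := by
    apply mul_pos hrR
    linarith
  have := hs _ (mem_zarembaValues_of_int r.1 r.2 h1.ne')
  rw [abs_of_pos h1] at this
  linarith

lemma le_mul_sub_of_gt {s t : ℝ} (hs : ∀ r ∈ zarembaValues s, t ≤ r) {r : ℤ × ℤ} (hr : 0 < r.2)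
    (h : r.2 * s < r.1) : t ≤ r.2 * (r.1 - r.2 * s) := by
  have hrR : (0 : ℝ) < r.2 := by exact_mod_cast hr
  have h1 : (r.2 : ℝ) * (s * r.2 - r.1) < 0 := by
    apply mul_neg_of_pos_of_neg hrR
    linarith
  have := hs _ (mem_zarembaValues_of_int r.1 r.2 h1.ne)
  rw [abs_of_neg h1] at this
  linarith

namespace MarkoffNode

variable {a c b : ℤ × ℤ}

/-- The numbers between a Markoff fraction `a` and the limit of its companions: consecutive members
of the sequence `vⱼ` are so close that the intervals of radius `1 / (3 q²)` around them overlap, so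
only the companions themselves remain. -/
lemma exists_eq_companion (h : MarkoffNode a c b) {m : ℕ} (hm : a.2 = m) {s t : ℝ} (ht : 1 / 3 < t)
    (hs : ∀ r ∈ zarembaValues s, t ≤ r) (has : a.1 < a.2 * s)
    (hlt : a.2 * (a.2 * s - a.1) < markoffLimit m) :
    ∃ j, 0 < j ∧ s = (companion a (j + 1)).1 / (companion a (j + 1)).2 := by
  have ha := h.triple.pos₁
  have haR : (0 : ℝ) < a.2 := by exact_mod_cast ha
  have hm0 : 0 < m := by omega
  have hmR : (m : ℝ) = a.2 := by
    rw [hm]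
    norm_cast
  have hex : ∃ n, (a.2 * s - a.1) * markoffLucas a.2 (n + 1) < markoffLucas a.2 n := by
    by_contra hc
    push Not at hc
    obtain ⟨n, hn⟩ := exists_nat_gt (1 / (markoffLimit m - a.2 * (a.2 * s - a.1)))
    rw [div_lt_iff₀ (sub_pos.2 hlt)] at hn
    have h1 := markoffLimit_sub_markoffLucas_le hm0 n
    have h2 := lt_markoffLucas_succ ha n
    have h3 := hc n
    rw [hmR, ← hm] at h1
    have h2R : (n : ℝ) < markoffLucas a.2 (n + 1) := by exact_mod_cast h2
    have h2' : (1 : ℝ) ≤ markoffLucas a.2 (n + 1) := by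
      exact_mod_cast markoffLucas_succ_pos ha n
    generalize (markoffLucas a.2 (n + 1) : ℝ) = w at *
    generalize (markoffLucas a.2 n : ℝ) = u at *
    have h4 : (markoffLimit m - a.2 * (a.2 * s - a.1)) * w ≤ markoffLimit m * w - a.2 * u := by
      have := mul_le_mul_of_nonneg_left h3 haR.le
      linarith
    have h5 : (markoffLimit m - a.2 * (a.2 * s - a.1)) * n <
        (markoffLimit m - a.2 * (a.2 * s - a.1)) * w :=
      mul_lt_mul_of_pos_left h2R (sub_pos.2 hlt)
    have h6 : 1 < markoffLimit m * w - a.2 * u := by linarith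
    nlinarith
  classical
  obtain ⟨n, hn, hmin⟩ : ∃ n, (a.2 * s - a.1) * markoffLucas a.2 (n + 1) < markoffLucas a.2 n ∧
      ∀ k < n, ¬ (a.2 * s - a.1) * markoffLucas a.2 (k + 1) < markoffLucas a.2 k :=
    ⟨Nat.find hex, Nat.find_spec hex, fun k hk => Nat.find_min hex hk⟩
  rcases n with _ | i
  · simp [markoffLucas] at hn
    linarith
  have hi := hmin i (Nat.lt_succ_self i)
  push Not at hi
  have hu := markoffLucas_succ_pos ha i
  have hw := markoffLucas_succ_pos ha (i + 1)
  have huR : (0 : ℝ) < markoffLucas a.2 (i + 1) := by exact_mod_cast hu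
  have hwR : (0 : ℝ) < markoffLucas a.2 (i + 1 + 1) := by exact_mod_cast hw
  rcases hi.eq_or_lt with heq | hgt
  · refine ⟨i, ?_, ?_⟩
    · rcases i with _ | i
      · simp [markoffLucas] at heq
        linarith
      · exact Nat.succ_pos i
    · rw [companion_succ]
      push_cast
      rw [heq]
      field_simp
      ring
  · exfalso
    have q1 := le_mul_sub_of_lt hs (r := companion a (i + 1))
      (by rw [companion_succ]; positivity) (by
        rw [companion_succ]
        push_cast
        linarith)
    have q2 := le_mul_sub_of_gt hs (r := companion a (i + 1 + 1))
      (by rw [companion_succ]; positivity) (by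
        rw [companion_succ]
        push_cast
        linarith)
    rw [companion_succ] at q1 q2
    have hinv : (markoffLucas a.2 (i + 1 + 1) : ℝ) ^ 2 + (markoffLucas a.2 (i + 1) : ℝ) ^ 2
        = 3 * a.2 * markoffLucas a.2 (i + 1 + 1) * markoffLucas a.2 (i + 1) + 1 := by
      exact_mod_cast markoffLucas_invariant (M := a.2) (i + 1)
    have hinv' : (markoffLucas a.2 (i + 1) : ℝ) ^ 2
        - markoffLucas a.2 (i + 1 + 1) * markoffLucas a.2 i = 1 := by
      have h1 := markoffLucas_invariant (M := a.2) i
      have h2 := markoffLucas_add_two (M := a.2) i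
      have : markoffLucas a.2 (i + 1) ^ 2
        - markoffLucas a.2 (i + 1 + 1) * markoffLucas a.2 i = 1 := by
        linear_combination h1 - markoffLucas a.2 i * h2
      exact_mod_cast this
    push_cast at q1 q2
    generalize (markoffLucas a.2 (i + 1 + 1) : ℝ) = w at *
    generalize (markoffLucas a.2 (i + 1) : ℝ) = u at *
    generalize (markoffLucas a.2 i : ℝ) = v at *
    have r1 := mul_le_mul_of_nonneg_left q1 (sq_nonneg w)
    have r2 := mul_le_mul_of_nonneg_left q2 (sq_nonneg u)
    have e : w ^ 2 * (a.2 * u * (a.2 * u * s - (a.1 * u + v))) +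
        u ^ 2 * (a.2 * w * (a.1 * w + u - a.2 * w * s)) = a.2 * u * w := by
      linear_combination (a.2 * u * w) * hinv'
    have r3 : t * (w ^ 2 + u ^ 2) ≤ a.2 * u * w := by linarith
    rw [hinv] at r3
    have r4 : 0 < a.2 * u * w := by positivity
    nlinarith

/-- If all values of a number between `a` and `b` are at least `t > 1 / 3`, then the smaller one of
the two denominators is bounded. -/
lemma denominator_le (h : MarkoffNode a c b) (hab : a.2 < b.2) {s t : ℝ} (ht : 1 / 3 < t)
    (hs : ∀ r ∈ zarembaValues s, t ≤ r) (has : a.1 < a.2 * s) (hsb : b.2 * s < b.1) :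
    (3 * t - 1) * a.2 ≤ t := by
  have ha := h.triple.pos₁
  have hb := h.triple.pos₂
  have q1 := le_mul_sub_of_lt hs ha has
  have q2 := le_mul_sub_of_gt hs hb hsb
  have hw0 : wedge a b ≤ b.2 := by
    rw [h.wedge_outer]
    rcases h.margin with h1 | h1 <;> omega
  have hwpos : 0 < wedge a b := by
    rw [h.wedge_outer]
    exact h.triple.vieta_pos
  have heq : a.2 ^ 2 + b.2 ^ 2 + wedge a b ^ 2 = 3 * a.2 * b.2 * wedge a b := by
    rw [h.wedge_outer]
    exact h.triple.vieta.eq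
  have hwR : (wedge a b : ℝ) = a.2 * b.1 - a.1 * b.2 := by
    unfold wedge
    push_cast
    ring
  have heqR : (a.2 : ℝ) ^ 2 + b.2 ^ 2 + (wedge a b : ℝ) ^ 2 = 3 * a.2 * b.2 * wedge a b := by
    exact_mod_cast heq
  have hw0R : (wedge a b : ℝ) ≤ b.2 := by exact_mod_cast hw0
  have hwposR : (0 : ℝ) < wedge a b := by exact_mod_cast hwpos
  have haR : (0 : ℝ) < a.2 := by exact_mod_cast ha
  have hbR : (0 : ℝ) < b.2 := by exact_mod_cast hb
  have r1 := mul_le_mul_of_nonneg_left q1 (sq_nonneg (b.2 : ℝ))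
  have r2 := mul_le_mul_of_nonneg_left q2 (sq_nonneg (a.2 : ℝ))
  have r3 : t * ((a.2 : ℝ) ^ 2 + b.2 ^ 2) ≤ a.2 * b.2 * wedge a b := by
    rw [hwR]
    linarith
  have r4 : wedge a b * (t * (3 * a.2 * b.2 - wedge a b)) ≤ wedge a b * (a.2 * b.2 : ℝ) := by
    calc wedge a b * (t * (3 * a.2 * b.2 - wedge a b)) = t * ((a.2 : ℝ) ^ 2 + b.2 ^ 2) := by
          linear_combination (-t) * heqR
      _ ≤ _ := by linarith
  have r5 := le_of_mul_le_mul_left r4 hwposR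
  have r6 : b.2 * ((3 * t - 1) * a.2) ≤ b.2 * t := by
    have : t * wedge a b ≤ t * b.2 := mul_le_mul_of_nonneg_left hw0R (by linarith)
    linarith
  exact le_of_mul_le_mul_left r6 hbR

end MarkoffNode

/-- The infima attached to Markoff fractions and to their companions (and `1`, which is attached to
the integers). -/
inductive IsMarkoffValue : ℝ → Prop
  | one : IsMarkoffValue 1
  | fraction {x y z : ℤ} (h : MarkoffTriple x y z) (hz : 2 * (x * y) ≤ z) :
      IsMarkoffValue (x * y / z)
  | companion {x y z : ℤ} (h : MarkoffTriple x y z) {j : ℕ} (hj : 0 < j) :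
      IsMarkoffValue (x * markoffLucas x j / markoffLucas x (j + 1))

namespace MarkoffNode

/-- The induction step of the classification, for a number between `a` and `b` when `a` has the
smaller denominator. Unless `s` is a companion of `a` it is separated from `a` by one of the
Markoff fractions next to `a`, so it lies between two fractions with larger denominators. -/
lemma isMarkoffValue_of_left_lt {t : ℝ} (ht : 1 / 3 < t) {a : ℤ × ℤ} {s : ℚ}
    (hs : ∀ r ∈ zarembaValues s, t ≤ r) (has : a.1 < a.2 * (s : ℝ))
    (hrec : ∀ a' c' b' : ℤ × ℤ, MarkoffNode a' c' b' → a'.2 ≠ b'.2 → a.2 < a'.2 → a.2 < b'.2 →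
      a'.1 < a'.2 * (s : ℝ) → b'.2 * (s : ℝ) < b'.1 → IsMarkoffValue (sInf (zarembaValues s)))
    {c b : ℤ × ℤ} (h : MarkoffNode a c b) (hab : a.2 < b.2) (hsb : b.2 * (s : ℝ) < b.1) :
    IsMarkoffValue (sInf (zarembaValues s)) := by
  have ha := h.triple.pos₁
  have haR : (0 : ℝ) < a.2 := by exact_mod_cast ha
  obtain ⟨m, hm⟩ := Int.eq_ofNat_of_zero_le ha.le
  have hm0 : 0 < m := by omega
  have hmR : (m : ℝ) = a.2 := by
    rw [hm]
    norm_cast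
  rcases lt_trichotomy (a.2 * (a.2 * (s : ℝ) - a.1)) (markoffLimit m) with hlt | heq | hgt
  · obtain ⟨j, hj, hsj⟩ := h.exists_eq_companion hm ht hs has hlt
    rw [hsj, h.sInf_zarembaValues_companion hj]
    exact .companion h.triple hj
  · exact absurd ⟨a.2 * (a.2 * s - a.1), by push_cast; exact heq⟩ (irrational_markoffLimit hm0)
  · obtain ⟨N, hN⟩ := exists_nat_gt ((a.2 : ℝ) ^ 2 / (a.2 * (a.2 * (s : ℝ) - a.1) - markoffLimit m))
    rw [div_lt_iff₀ (sub_pos.2 hgt)] at hN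
    obtain ⟨k, hk⟩ : ∃ k : ℕ, (N : ℤ) < c.2 + k := ⟨N, by have := h.triple.pos₃; omega⟩
    induction k generalizing c b with
    | zero =>
      have hc := h.triple.pos₃
      have hcR : (1 : ℝ) ≤ c.2 := by exact_mod_cast hc
      have hNc : (N : ℝ) ≤ c.2 := by
        have : (N : ℤ) ≤ c.2 := by push_cast at hk; omega
        exact_mod_cast this
      have htr := h.triple
      have h2 := h.two_mul_le
      rw [hm] at htr h2
      have hb := htr.sub_markoffLimit h2
      rw [hmR] at hb
      have hac : (a.2 : ℝ) * c.1 - a.1 * c.2 = b.2 := by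
        have := h.wedge_left
        unfold wedge at this
        exact_mod_cast this
      -- `c` is so close to the limit of the companions that it lies below `s`
      have hcs : (c.1 : ℝ) < c.2 * s := by
        by_contra hcon
        push Not at hcon
        have h3 : a.2 * (a.2 * (s : ℝ) - a.1) ≤ a.2 * b.2 / c.2 := by
          rw [le_div_iff₀ (by linarith), ← hac]
          have := mul_le_mul_of_nonneg_left hcon (sq_nonneg (a.2 : ℝ))
          linarith
        have h4 : (a.2 * (a.2 * (s : ℝ) - a.1) - markoffLimit m) * N ≤ a.2 ^ 2 := by
          refine le_trans ?_ hb.2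
          have h5 : (N : ℝ) ≤ c.2 ^ 2 := by nlinarith
          have h6 : 0 < a.2 * (a.2 * (s : ℝ) - a.1) - markoffLimit m := sub_pos.2 hgt
          calc (a.2 * (a.2 * (s : ℝ) - a.1) - markoffLimit m) * N
              ≤ (a.2 * (a.2 * (s : ℝ) - a.1) - markoffLimit m) * c.2 ^ 2 := by gcongr
            _ ≤ _ := by gcongr
        linarith
      exact hrec _ _ _ h.rightChild h.right_lt.ne' h.left_lt hab hcs hsb
    | succ k ih =>
      rcases lt_trichotomy (c.2 * (s : ℝ)) c.1 with hlt' | heq' | hgt'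
      · refine ih h.leftChild h.left_lt hlt' ?_
        have h1 := h.left_lt
        have h2 := h.right_lt
        have h3 : c.2 ≤ a.2 * c.2 := le_mul_of_one_le_left h.triple.pos₃.le ha
        simp only [Prod.snd_sub, Prod.smul_snd, smul_eq_mul]
        push_cast at hk
        have h4 : 3 * a.2 * c.2 = 3 * (a.2 * c.2) := by ring
        have := h.triple.pos₃
        omega
      · have hcR : (c.2 : ℝ) ≠ 0 := by exact_mod_cast h.triple.pos₃.ne'
        have : (s : ℝ) = c.1 / c.2 := by
          rw [eq_div_iff hcR]
          linarith
        rw [this, h.sInf_zarembaValues]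
        exact .fraction h.triple h.two_mul_le
      · exact hrec _ _ _ h.rightChild h.right_lt.ne' h.left_lt hab hgt' hsb

/-- The classification between two neighbouring Markoff fractions, by induction on the gap between
the smaller denominator and its bound `t / (3 t - 1)`. The reflection `s ↦ -s` exchanges the two
fractions. -/
lemma isMarkoffValue {t : ℝ} (ht : 1 / 3 < t) (n : ℕ) : ∀ (s : ℚ) (a c b : ℤ × ℤ),
    (∀ r ∈ zarembaValues s, t ≤ r) → MarkoffNode a c b → a.2 ≠ b.2 →
    t < (3 * t - 1) * (a.2 + n) → t < (3 * t - 1) * (b.2 + n) →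
    a.1 < a.2 * (s : ℝ) → b.2 * (s : ℝ) < b.1 → IsMarkoffValue (sInf (zarembaValues s)) := by
  induction n with
  | zero =>
    intro s a c b hs h hab hta htb has hsb
    exfalso
    rw [Nat.cast_zero, add_zero] at hta htb
    rcases lt_or_gt_of_ne hab with hlt | hgt
    · have := h.denominator_le hlt ht hs has hsb
      linarith
    · have := h.reflect.denominator_le hgt ht (s := -s)
        (by rwa [zarembaValues_neg]) (by push_cast; linarith) (by push_cast; linarith)
      simp only at this
      linarith
  | succ n ih =>
    intro s a c b hs h hab hta htb has hsb
    have step : ∀ x y : ℤ, x < y → t < (3 * t - 1) * (x + (n + 1 : ℕ)) →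
        t < (3 * t - 1) * (y + n) := by
      intro x y hxy hx
      have : (x : ℝ) + 1 ≤ y := by exact_mod_cast hxy
      refine hx.trans_le ?_
      push_cast
      apply mul_le_mul_of_nonneg_left <;> linarith
    rcases lt_or_gt_of_ne hab with hlt | hgt
    · refine isMarkoffValue_of_left_lt ht hs has ?_ h hlt hsb
      intro a' c' b' h' hne h1 h2 h3 h4
      exact ih s a' c' b' hs h' hne (step _ _ h1 hta) (step _ _ h2 hta) h3 h4
    · have hs' : ∀ r ∈ zarembaValues ((-s : ℚ) : ℝ), t ≤ r := by
        push_cast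
        rwa [zarembaValues_neg]
      have : IsMarkoffValue (sInf (zarembaValues ((-s : ℚ) : ℝ))) := by
        refine isMarkoffValue_of_left_lt ht hs' (a := (-b.1, b.2)) ?_ ?_ h.reflect hgt ?_
        · push_cast
          linarith
        · intro a' c' b' h' hne h1 h2 h3 h4
          exact ih (-s) a' c' b' hs' h' hne (step _ _ h1 htb) (step _ _ h2 htb) h3 h4
        · push_cast
          linarith
      push_cast at this
      rwa [zarembaValues_neg] at this

end MarkoffNode

lemma sInf_zarembaValues_zero : sInf (zarembaValues 0) = 1 := by
  have := sInf_zarembaValues_eq (c := (0, 1)) (by norm_num) (L := 1) ?_ (r₀ := (1, 1))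
    (by norm_num) (by norm_num [wedge]) (by norm_num [wedge])
  · simpa using this
  · intro r hr hne
    have h1 : 1 ≤ |wedge (0, 1) r| := Int.one_le_abs hne
    have h2 : 1 * 1 ≤ r.2 * |wedge (0, 1) r| := mul_le_mul hr h1 (by norm_num) hr.le
    simp only [Int.cast_one, mul_one] at h2 ⊢
    exact_mod_cast h2

lemma isMarkoffValue_of_mem {r : ℝ} (hr : r ∈ zarembaSpectrum) (h3 : 1 / 3 < r) :
    IsMarkoffValue r := by
  rw [zarembaSpectrum_eq] at hr
  obtain ⟨s, rfl⟩ := hr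
  obtain ⟨s', hs', h0, h1⟩ : ∃ s' : ℚ, zarembaValues (s : ℝ) = zarembaValues (s' : ℝ) ∧ 0 ≤ s' ∧
      s' < 1 := by
    refine ⟨Int.fract s, ?_, Int.fract_nonneg s, Int.fract_lt_one s⟩
    rw [Int.fract]
    push_cast
    rw [zarembaValues_sub_int]
  rw [hs'] at h3 ⊢
  clear hs'
  set t := sInf (zarembaValues (s' : ℝ)) with ht
  have hs : ∀ r ∈ zarembaValues (s' : ℝ), t ≤ r := fun r hr =>
    csInf_le (zarembaValues_bddBelow _) hr
  rcases h0.eq_or_lt with h0 | h0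
  · rw [ht, ← h0, Rat.cast_zero, sInf_zarembaValues_zero]
    exact .one
  have h0R : (0 : ℝ) < s' := by exact_mod_cast h0
  have h1R : (s' : ℝ) < 1 := by exact_mod_cast h1
  obtain ⟨n, hn⟩ := exists_nat_gt (t / (3 * t - 1))
  have h3' : 0 < 3 * t - 1 := by linarith
  rw [div_lt_iff₀ h3'] at hn
  have hn' : ∀ x : ℤ, 0 < x → t < (3 * t - 1) * (x + n) := by
    intro x hx
    have hxR : (0 : ℝ) < x := by exact_mod_cast hx
    have := mul_pos h3' hxR
    linarith
  rcases lt_trichotomy (s' : ℝ) (1 / 2) with hlt | heq | hgt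
  · refine MarkoffNode.isMarkoffValue h3 n s' _ _ _ hs MarkoffNode.root.leftChild (by norm_num)
      (hn' _ (by norm_num)) (hn' _ (by norm_num)) ?_ ?_
    · simpa using h0R
    · norm_num
      linarith
  · have := MarkoffNode.root.sInf_zarembaValues
    norm_num at this
    rw [ht, heq]
    norm_num
    rw [this]
    have := IsMarkoffValue.fraction MarkoffNode.root.triple (by norm_num)
    norm_num at this
    exact this
  · refine MarkoffNode.isMarkoffValue h3 n s' _ _ _ hs MarkoffNode.root.rightChild (by norm_num)
      (hn' _ (by norm_num)) (hn' _ (by norm_num)) ?_ ?_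
    · norm_num
      linarith
    · simpa using h1R

/-! ### Limit points -/

lemma MarkoffTriple.exists_markoffLimit_near {x y z : ℤ} (h : MarkoffTriple x y z)
    (hz : 2 * (x * y) ≤ z) (hxy : x ≤ y) : ∃ m j k : ℕ, IsMarkoffNumber m ∧ j ≤ k ∧
      (x * y / z : ℝ) = m * j / k ∧ (3 * (x * y / z : ℝ) - 1) * m ^ 2 ≤ 1 ∧
      |(x * y / z : ℝ) - markoffLimit m| * k ≤ m ^ 2 := by
  have hM := h.isMarkoffNumber
  have hx0 := h.pos₁
  have hy0 := h.pos₂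
  have hz0 := h.pos₃
  obtain ⟨m, rfl⟩ := Int.eq_ofNat_of_zero_le hx0.le
  obtain ⟨j, rfl⟩ := Int.eq_ofNat_of_zero_le hy0.le
  obtain ⟨k, rfl⟩ := Int.eq_ofNat_of_zero_le hz0.le
  rw [Int.toNat_natCast] at hM
  obtain ⟨h1, h2⟩ := h.sub_markoffLimit hz
  have hm0 : 0 < m := by exact_mod_cast hx0
  have hq := markoffLimit_quadratic hm0
  have hl := markoffLimit_lt_half hm0
  have hl0 := markoffLimit_pos hm0
  have hmR : (1 : ℝ) ≤ m := by exact_mod_cast hm0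
  have hjR : (m : ℝ) ≤ j := by exact_mod_cast hxy
  have hkR : (1 : ℝ) ≤ k := by exact_mod_cast hz0
  have hzR : 2 * ((m : ℝ) * j) ≤ k := by exact_mod_cast hz
  have hk2 : 2 * (m : ℝ) ^ 2 ≤ k := by nlinarith
  simp only [Int.cast_natCast] at *
  refine ⟨m, j, k, hM, ?_, rfl, ?_, ?_⟩
  · have : (j : ℝ) ≤ k := by nlinarith
    exact_mod_cast this
  · generalize (m * j / k : ℝ) = v at *
    have hkk : 4 * (m : ℝ) ^ 4 ≤ k ^ 2 := by nlinarith
    have h3 : 4 * (m ^ 2 * ((v - markoffLimit m) * m ^ 2)) ≤ (m : ℝ) ^ 2 := by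
      have h4 : (v - markoffLimit m) * (4 * m ^ 4) ≤ (v - markoffLimit m) * k ^ 2 :=
        mul_le_mul_of_nonneg_left hkk (by linarith)
      linarith
    have h5 : (v - markoffLimit m) * m ^ 2 ≤ 1 / 4 := by
      have : (0 : ℝ) < (m : ℝ) ^ 2 := by positivity
      nlinarith
    nlinarith
  · rw [abs_of_pos (sub_pos.2 h1)]
    refine le_trans ?_ h2
    have : (k : ℝ) ≤ k ^ 2 := by nlinarith
    exact mul_le_mul_of_nonneg_left this (sub_pos.2 h1).le

/-- Every number `r ≠ 1` of the list is a fraction `m j / k` with a Markoff number `m` which is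
bounded unless `r` is close to `1 / 3`, and it is close to `markoffLimit m` when `k` is large. -/
lemma IsMarkoffValue.exists_markoffLimit_near {r : ℝ} (hr : IsMarkoffValue r) (h1 : r ≠ 1) :
    ∃ m j k : ℕ, IsMarkoffNumber m ∧ j ≤ k ∧ r = m * j / k ∧ (3 * r - 1) * m ^ 2 ≤ 1 ∧
      |r - markoffLimit m| * k ≤ m ^ 2 := by
  cases hr with
  | one => exact absurd rfl h1
  | @fraction x y z h hz =>
    rcases le_total x y with hxy | hxy
    · exact h.exists_markoffLimit_near hz hxy
    · rw [mul_comm (x : ℝ)]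
      exact h.swap.exists_markoffLimit_near (by rwa [mul_comm y]) hxy
  | @companion x y z h j hj =>
    have hM := h.isMarkoffNumber
    have hx0 := h.pos₁
    obtain ⟨m, rfl⟩ := Int.eq_ofNat_of_zero_le hx0.le
    rw [Int.toNat_natCast] at hM
    have hm0 : 0 < m := by exact_mod_cast hx0
    have hlt := mul_markoffLucas_lt hm0 j
    have hle := markoffLimit_sub_markoffLucas_le hm0 j
    obtain ⟨b1, b2, -⟩ := markoffLucas_succ_bounds hx0 j
    have b3 := markoffLucas_succ_pos hx0 j
    have b4 : markoffLucas m j ≤ markoffLucas m (j + 1) := by nlinarith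
    obtain ⟨p, hp⟩ := Int.eq_ofNat_of_zero_le b1
    obtain ⟨q, hqq⟩ := Int.eq_ofNat_of_zero_le b3.le
    rw [hp, hqq] at hlt hle b4
    rw [hqq] at b3
    rw [hp, hqq] at h1 ⊢
    have hq := markoffLimit_quadratic hm0
    have hl := markoffLimit_lt_half hm0
    have hl0 := markoffLimit_pos hm0
    have hmR : (1 : ℝ) ≤ m := by exact_mod_cast hm0
    have hqR : (0 : ℝ) < q := by exact_mod_cast b3
    simp only [Int.cast_natCast] at hlt hle h1 ⊢
    refine ⟨m, p, q, hM, by exact_mod_cast b4, rfl, ?_, ?_⟩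
    · have h3 : (m * p / q : ℝ) ≤ markoffLimit m := by
        rw [div_le_iff₀ hqR]
        exact hlt.le
      generalize (m * p / q : ℝ) = v at *
      have : (3 * v - 1) * m ^ 2 ≤ (3 * markoffLimit m - 1) * (m : ℝ) ^ 2 := by
        gcongr
      nlinarith
    · have e : |(m * p / q : ℝ) - markoffLimit m| * q = markoffLimit m * q - m * p := by
        rw [abs_sub_comm, abs_of_nonneg]
        · field_simp
        · rw [sub_nonneg, div_le_iff₀ hqR]
          exact hlt.le
      rw [e]
      have hq1 : (1 : ℝ) ≤ q := by exact_mod_cast b3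
      nlinarith

/-- Near a number `x > 1 / 3` only finitely many Markoff numbers `m` contribute values, and those
with a fixed `m` accumulate only at `markoffLimit m`. -/
lemma exists_eq_markoffLimit {x : ℝ} (hx : 1 / 3 < x) (hacc : AccPt x (𝓟 zarembaSpectrum)) :
    ∃ m : ℕ, IsMarkoffNumber m ∧ x = markoffLimit m := by
  by_contra hcon
  push Not at hcon
  obtain ⟨B, hB⟩ := exists_nat_gt (1 / (3 * ((x + 1 / 3) / 2) - 1))
  have hε : 0 < 3 * ((x + 1 / 3) / 2) - 1 := by linarith
  rw [div_lt_iff₀ hε] at hB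
  obtain ⟨δ, hδ, hδB⟩ : ∃ δ > 0, ∀ m ≤ B, IsMarkoffNumber m → δ ≤ |x - markoffLimit m| := by
    have hfin : ({m | m ≤ B ∧ IsMarkoffNumber m} : Set ℕ).Finite :=
      (Set.finite_Iic B).subset fun m hm => hm.1
    have hcl := (hfin.image markoffLimit).isClosed
    have hmem : x ∈ (markoffLimit '' {m | m ≤ B ∧ IsMarkoffNumber m})ᶜ := by
      rintro ⟨m, hm, h⟩
      exact hcon m hm.2 h.symm
    obtain ⟨δ, hδ, hball⟩ := Metric.isOpen_iff.1 hcl.isOpen_compl x hmem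
    refine ⟨δ, hδ, fun m hm hM => ?_⟩
    by_contra hlt
    push Not at hlt
    have : markoffLimit m ∈ Metric.ball x δ := by
      rwa [Metric.mem_ball, Real.dist_eq, abs_sub_comm]
    exact hball this ⟨m, ⟨hm, hM⟩, rfl⟩
  obtain ⟨K, hK⟩ := exists_nat_gt (B ^ 2 / (δ / 2))
  rw [div_lt_iff₀ (by positivity)] at hK
  -- the finitely many values which may lie near `x`
  let G : Set ℝ := insert 1
    ((fun p : ℕ × ℕ × ℕ => (p.1 * p.2.1 / p.2.2 : ℝ)) '' (Iic B ×ˢ Iic K ×ˢ Iic K))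
  have hG : G.Finite := by
    refine Set.Finite.insert _ (Set.Finite.image _ ?_)
    exact (finite_Iic B).prod ((finite_Iic K).prod (finite_Iic K))
  have hsub : ∀ r ∈ zarembaSpectrum, (x + 1 / 3) / 2 < r → |r - x| < δ / 2 → r ∈ G := by
    intro r hr hr1 hr2
    by_cases h1 : r = 1
    · exact Or.inl h1
    right
    obtain ⟨m, j, k, hM, hjk, hrm, hm1, hk⟩ :=
      (isMarkoffValue_of_mem hr (by linarith)).exists_markoffLimit_near h1
    have hmB : m ≤ B := by
      have hm0 : 0 < m := by
        obtain ⟨_, _, h, _⟩ := hM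
        exact h
      have hmR : (1 : ℝ) ≤ m := by exact_mod_cast hm0
      have h2 : (3 * ((x + 1 / 3) / 2) - 1) * m ≤ 1 := by
        calc (3 * ((x + 1 / 3) / 2) - 1) * m ≤ (3 * ((x + 1 / 3) / 2) - 1) * (m : ℝ) ^ 2 := by
              apply mul_le_mul_of_nonneg_left _ hε.le
              nlinarith
          _ ≤ (3 * r - 1) * (m : ℝ) ^ 2 := by gcongr
          _ ≤ 1 := hm1
      have h3 : (m : ℝ) < B := by
        by_contra hc
        push Not at hc
        have := mul_le_mul_of_nonneg_left hc hε.le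
        linarith
      exact_mod_cast h3.le
    have hkK : k ≤ K := by
      have hd := hδB m hmB hM
      have h2 : δ / 2 ≤ |r - markoffLimit m| := by
        have := abs_sub_le x r (markoffLimit m)
        rw [abs_sub_comm x r] at this
        linarith
      have h3 : (δ / 2) * k ≤ (B : ℝ) ^ 2 := by
        calc (δ / 2) * k ≤ |r - markoffLimit m| * k := by gcongr
          _ ≤ (m : ℝ) ^ 2 := hk
          _ ≤ _ := by gcongr
      have h4 : (k : ℝ) < K := by
        by_contra hc
        push Not at hc
        nlinarith
      exact_mod_cast h4.le
    exact ⟨(m, j, k), ⟨hmB, hjk.trans hkK, hkK⟩, hrm.symm⟩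
  have hU : (Ioi ((x + 1 / 3) / 2) ∩ Metric.ball x (δ / 2)) ∩ (G \ {x})ᶜ ∈ 𝓝 x := by
    refine inter_mem
      (inter_mem (Ioi_mem_nhds (by linarith)) (Metric.ball_mem_nhds x (by positivity)))
      ((hG.subset sdiff_subset).isClosed.isOpen_compl.mem_nhds ?_)
    simp
  obtain ⟨r, ⟨⟨⟨h1, h2⟩, h3⟩, hr⟩, hne⟩ := accPt_iff_nhds.1 hacc _ hU
  exact h3 ⟨hsub r hr h1 (by rwa [Metric.mem_ball, Real.dist_eq] at h2), hne⟩

/-- Every positive solution of Markoff's equation with a strictly largest entry is found in the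
tree of Markoff fractions. -/
lemma exists_markoffNode (n : ℕ) : ∀ x y z : ℤ, 0 < x → 0 < y → z ≤ n →
    x ^ 2 + y ^ 2 + z ^ 2 = 3 * x * y * z → x < z → y < z →
    ∃ a c b, MarkoffNode a c b ∧ a.2 = x ∧ b.2 = y ∧ c.2 = z := by
  induction n with
  | zero =>
    intro x y z hx hy hz _ hxz _
    norm_num at hz
    omega
  | succ n ih =>
    intro x y z hx hy hz he hxz hyz
    push_cast at hz
    have hprod : z * (3 * x * y - z) = x ^ 2 + y ^ 2 := by linear_combination -he
    have hpos : 0 < 3 * x * y - z := by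
      have : 0 < z * (3 * x * y - z) := by rw [hprod]; positivity
      exact pos_of_mul_pos_right this (by omega)
    rcases lt_trichotomy x y with hlt | heq | hgt
    · have hlt' : 3 * x * y - z < y := by
        have h1 : (z - y) * (y - (3 * x * y - z)) = y ^ 2 - x ^ 2 + 3 * y ^ 2 * (x - 1) := by
          linear_combination he
        have h2 : 0 < (z - y) * (y - (3 * x * y - z)) := by
          rw [h1]
          have : 0 ≤ 3 * y ^ 2 * (x - 1) := mul_nonneg (by positivity) (by omega)
          nlinarith
        have := pos_of_mul_pos_right h2 (by omega)
        omega
      obtain ⟨a, c, b, h, rfl, hb, rfl⟩ := ih x (3 * x * y - z) y hx hpos (by omega)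
        (by linear_combination he) hlt hlt'
      refine ⟨_, _, _, h.leftChild, rfl, rfl, ?_⟩
      simp only [Prod.snd_sub, Prod.smul_snd, smul_eq_mul]
      rw [hb]
      ring
    · subst heq
      have hle : 3 * x * x - z ≤ x := by
        have h1 : (z - x) * (x - (3 * x * x - z)) = 3 * x ^ 2 * (x - 1) := by
          linear_combination he
        have h2 : 0 ≤ (z - x) * (x - (3 * x * x - z)) := by
          rw [h1]
          exact mul_nonneg (by positivity) (by omega)
        have := nonneg_of_mul_nonneg_right h2 (by omega)
        omega
      -- `z ≥ 2x²` and `z (3x² - z) = 2x²` leave `z = 2x²`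
      have hz2 : 2 * x ^ 2 ≤ z := by nlinarith
      have hone : 3 * x * x - z = 1 := by nlinarith
      have hx1 : x ^ 2 = 1 := by
        rw [hone] at hprod
        linarith
      have hx2 : x = 1 := by nlinarith
      subst hx2
      have hz' : z = 2 := by linarith
      subst hz'
      exact ⟨_, _, _, MarkoffNode.root, rfl, rfl, rfl⟩
    · have hlt' : 3 * x * y - z < x := by
        have h1 : (z - x) * (x - (3 * x * y - z)) = x ^ 2 - y ^ 2 + 3 * x ^ 2 * (y - 1) := by
          linear_combination he
        have h2 : 0 < (z - x) * (x - (3 * x * y - z)) := by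
          rw [h1]
          have : 0 ≤ 3 * x ^ 2 * (y - 1) := mul_nonneg (by positivity) (by omega)
          nlinarith
        have := pos_of_mul_pos_right h2 (by omega)
        omega
      obtain ⟨a, c, b, h, ha, rfl, rfl⟩ := ih (3 * x * y - z) y x hpos hy (by omega)
        (by linear_combination he) hlt' hgt
      refine ⟨_, _, _, h.rightChild, rfl, rfl, ?_⟩
      simp only [Prod.snd_sub, Prod.smul_snd, smul_eq_mul]
      rw [ha]
      ring

lemma IsMarkoffNumber.exists_markoffNode {m : ℕ} (hm : IsMarkoffNumber m) (N : ℕ) :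
    ∃ a c b, MarkoffNode a c b ∧ a.2 = m ∧ (N : ℤ) < c.2 := by
  have key : ∀ m y z : ℕ, 0 < m → 0 < y → y ≤ z → m ^ 2 + y ^ 2 + z ^ 2 = 3 * m * y * z →
      ∃ a c b, MarkoffNode a c b ∧ a.2 = m := by
    intro m y z h1 h2 hyz he
    zify at h1 h2 hyz he
    have hmz : (z : ℤ) ≤ m * z := le_mul_of_one_le_left (by omega) h1
    have hmz' : (m : ℤ) ≤ m * z := le_mul_of_one_le_right (by omega) (by omega)
    have hmz3 : (3 : ℤ) * m * z = 3 * (m * z) := by ring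
    obtain ⟨a, c, b, h, ha, -, -⟩ := _root_.exists_markoffNode (3 * m * z - y : ℤ).toNat
      m z (3 * m * z - y) h1 (by omega) (Int.self_le_toNat _) (by linear_combination he)
      (by omega) (by omega)
    exact ⟨a, c, b, h, ha⟩
  obtain ⟨y, z, h1, h2, h3, he⟩ := hm
  obtain ⟨a, c, b, h, ha⟩ : ∃ a c b, MarkoffNode a c b ∧ a.2 = m := by
    rcases le_total y z with hyz | hyz
    · exact key m y z h1 h2 hyz he
    · exact key m z y h1 h3 hyz (by linarith)
  clear he
  induction N with
  | zero => exact ⟨a, c, b, h, ha, h.triple.pos₃⟩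
  | succ N ih =>
    obtain ⟨a, c, b, h, ha, hN⟩ := ih
    refine ⟨_, _, _, h.leftChild, ha, ?_⟩
    have := h.leftChild.right_lt
    push_cast
    omega

/-- The Markoff fractions next to one with denominator `m` have values converging to
`markoffLimit m` from above. -/
lemma accPt_markoffLimit {m : ℕ} (hm : IsMarkoffNumber m) :
    AccPt (markoffLimit m) (𝓟 (zarembaSpectrum ∩ Ioi (1 / 3 : ℝ))) := by
  rw [accPt_iff_nhds]
  intro U hU
  obtain ⟨ε, hε, hball⟩ := Metric.mem_nhds_iff.1 hU
  obtain ⟨N, hN⟩ := exists_nat_gt ((m : ℝ) ^ 2 / ε)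
  rw [div_lt_iff₀ hε] at hN
  obtain ⟨a, c, b, h, ha, hc⟩ := hm.exists_markoffNode N
  have hm0 : 0 < m := by
    obtain ⟨_, _, h, _⟩ := hm
    exact h
  have htr := h.triple
  have h2 := h.two_mul_le
  rw [ha] at htr h2
  obtain ⟨hb1, hb2⟩ := htr.sub_markoffLimit h2
  have hval := h.sInf_zarembaValues
  rw [ha, Int.cast_natCast] at hval
  have hNc : (N : ℝ) < c.2 := by exact_mod_cast hc
  have hc1 : (1 : ℝ) ≤ c.2 := by exact_mod_cast h.triple.pos₃
  refine ⟨m * b.2 / c.2, ⟨hball ?_, ?_, ?_⟩, hb1.ne'⟩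
  · rw [Metric.mem_ball, Real.dist_eq, abs_of_pos (sub_pos.2 hb1)]
    by_contra hcon
    push Not at hcon
    have h3 : ε * N ≤ (m * b.2 / c.2 - markoffLimit m) * (c.2 : ℝ) ^ 2 := by
      have : (N : ℝ) ≤ (c.2 : ℝ) ^ 2 := by nlinarith
      gcongr
    linarith
  · rw [zarembaSpectrum_eq]
    refine ⟨(c.1 / c.2 : ℚ), ?_⟩
    rw [← hval]
    push_cast
    rfl
  · exact (one_third_lt_markoffLimit hm0).trans hb1

theorem mainTheorem1 :
    (∀ m : ℕ, IsMarkoffNumber m →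
      AccPt (markoffLimit m) (𝓟 (zarembaSpectrum ∩ Ioi (1 / 3 : ℝ)))) ∧
    (∀ x : ℝ, 1 / 3 < x → AccPt x (𝓟 zarembaSpectrum) →
      ∃ m : ℕ, IsMarkoffNumber m ∧ x = markoffLimit m) := by
  exact ⟨fun _ hm => accPt_markoffLimit hm, fun _ hx h => exists_eq_markoffLimit hx h⟩
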